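/- For an injective map $f:M\to X$ between metric spaces let $\mathrm{dist}(f)=\sup_{x\ne y}\frac{d_X(f(x),f(y))}{d_M(x,y)}\cdot\sup_{x\neq y}\frac{d_M(x,y)}{d_X(f(x),f(y))}$, and let $c_2(M)$ be the infimum of $\mathrm{dist}(f)$ over all injective $f:M\to\ell_2$. We say that $M$ $\alpha$-embeds in $\ell_2$ if $c_2(M)\le\alpha$. A *Q space* of a finite metric space $M$ is a partition $\mathcal U$ of $M$ into nonempty pairwise disjoint subsets, equipped with the geodesic metric $$d_{\mathrm{geo}}(U,W)=\inf\Big\{\sum_{r=1}^{k}d_M(V_r,V_{r-1}) : k\ge 0,\ V_0,\dots,V_k\in\mathcal U,\ V_0=U,\ V_k=W\Big\},$$ where $d_M(U,V)=\inf\{d_M(u,v):u\in U,\ v\in V\}$; its size is $|\mathcal U|$. For $n\ge 1$ and $\alpha\ge 1$ let $\mathcal Q_2(\alpha,n)$ be the largest integer $m$ such that every $n$-point metric space has a Q space of size $m$ that $\alpha$-embeds in $\ell_2$. **Theorem.** 1. For every $1<\alpha<\sqrt2$ there is a constant $C_1(\alpha)$ such that $\mathcal Q_2(\alpha,n)\le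 C_1(\alpha)$ for every integer $n\ge1$. 2. For every $\sqrt2<\alpha<2$ there are constants $0<c(\alpha)\le C(\alpha)<1$ and an integer $n_0$ such that $\mathcal Q_2(\alpha,n)\ge n^{c(\alpha)}$ for every integer $n\ge1$, and $\mathcal Q_2(\alpha,n)\le n^{C(\alpha)}$ for every $n\ge n_0$. 3. For every $\alpha\ge2$ there are an integer $n_0$ and constants $0<c'(\alpha),C'(\alpha)<1$ such that $c'(\alpha)\,n\le\mathcal Q_2(\alpha,n)\le C'(\alpha)\,n$ for every $n\ge n_0$. -/

import Mathlib

open scoped ENNReal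

namespace MetricQuotient

noncomputable section

/-- The distortion of an injective map `f : M → X` between metric spaces: the supremum over `x ≠ y`
of `d(f x, f y) / d(x, y)` times the supremum over `x ≠ y` of `d(x, y) / d(f x, f y)`. It is used
for injective maps only (for other maps the second supremum is infinite). -/
def distortion {M X : Type*} [MetricSpace M] [MetricSpace X] (f : M ↪ X) : ℝ≥0∞ :=
  (⨆ (x : M) (y : M) (_ : x ≠ y), edist (f x) (f y) / edist x y) *
    (⨆ (x : M) (y : M) (_ : x ≠ y), edist x y / edist (f x) (f y))

/-- `c_X(M)`: the least distortion (as an infimum) required to embed `M` in `X`. -/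
def leastDistortion (M X : Type*) [MetricSpace M] [MetricSpace X] : ℝ≥0∞ :=
  ⨅ f : M ↪ X, distortion f

/-- `M` `α`-embeds in `X`: `c_X(M) ≤ α`. -/
def AlphaEmbeds (α : ℝ) (M X : Type*) [MetricSpace M] [MetricSpace X] : Prop :=
  leastDistortion M X ≤ ENNReal.ofReal α

/-- The underlying set of a Q space of `M`: the set of classes of a partition of `M` into nonempty
pairwise disjoint subsets, the partition being given by its equivalence relation. -/
def QSpace {M : Type*} (s : Setoid M) : Type _ := Quotient s

namespace QSpace

variable {M : Type*} {s : Setoid M}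

/-- The class of a point. -/
def mk (s : Setoid M) (x : M) : QSpace s := Quotient.mk s x

theorem exists_rep (U : QSpace s) : ∃ x, mk s x = U := Quotient.exists_rep U

instance [Finite M] : Finite (QSpace s) := inferInstanceAs (Finite (Quotient s))

variable [MetricSpace M]

/-- `d_M(U, V) = inf {d_M(u, v) : u ∈ U, v ∈ V}` for two classes `U`, `V`. -/
def classDist (U V : QSpace s) : ℝ :=
  sInf {r : ℝ | ∃ u v : M, mk s u = U ∧ mk s v = V ∧ dist u v = r}

/-- The lengths `∑ d_M(V_{r+1}, V_r)` of all finite chains `U = V_0, V_1, …, V_k = W` of classes. -/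
def chainLengths (U W : QSpace s) : Set ℝ :=
  {ℓ : ℝ | ∃ (k : ℕ) (V : ℕ → QSpace s), V 0 = U ∧ V k = W ∧
    ∑ r ∈ Finset.range k, classDist (V (r + 1)) (V r) = ℓ}

/-- The geodesic distance of two classes: the infimum of the lengths of the chains joining them. -/
def geoDist (U W : QSpace s) : ℝ := sInf (chainLengths U W)

theorem classDist_nonneg (U V : QSpace s) : 0 ≤ classDist U V := by
  apply Real.sInf_nonneg
  rintro _ ⟨u, v, -, -, rfl⟩
  exact dist_nonneg

theorem classDist_comm (U V : QSpace s) : classDist U V = classDist V U := by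
  unfold classDist
  congr 1
  ext r
  constructor <;> rintro ⟨u, v, hu, hv, h⟩ <;> exact ⟨v, u, hv, hu, by rw [dist_comm]; exact h⟩

theorem chainLengths_nonneg {U W : QSpace s} {l : ℝ} (h : l ∈ chainLengths U W) : 0 ≤ l := by
  obtain ⟨k, V, -, -, rfl⟩ := h
  exact Finset.sum_nonneg fun r _ => classDist_nonneg _ _

theorem chainLengths_bddBelow (U W : QSpace s) : BddBelow (chainLengths U W) :=
  ⟨0, fun _ h => chainLengths_nonneg h⟩

theorem chainLengths_nonempty (U W : QSpace s) : (chainLengths U W).Nonempty :=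
  ⟨_, 1, fun r => if r = 0 then U else W, by simp, by simp, rfl⟩

theorem chainLengths_symm {U W : QSpace s} {l : ℝ} (h : l ∈ chainLengths U W) :
    l ∈ chainLengths W U := by
  obtain ⟨k, V, h0, hk, rfl⟩ := h
  refine ⟨k, fun r => V (k - r), by simpa using hk, by simpa using h0, ?_⟩
  rw [← Finset.sum_range_reflect (fun r => classDist (V (r + 1)) (V r))]
  refine Finset.sum_congr rfl fun r hr => ?_
  have hr' := Finset.mem_range.1 hr
  rw [classDist_comm, show k - 1 - r + 1 = k - r by omega, show k - 1 - r = k - (r + 1) by omega]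

theorem chainLengths_add {U V W : QSpace s} {a b : ℝ} (ha : a ∈ chainLengths U V)
    (hb : b ∈ chainLengths V W) : a + b ∈ chainLengths U W := by
  obtain ⟨k, F, hF0, hFk, rfl⟩ := ha
  obtain ⟨l, G, hG0, hGl, rfl⟩ := hb
  refine ⟨k + l, fun r => if r < k then F r else G (r - k), ?_, by simpa using hGl, ?_⟩
  · by_cases hk : 0 < k
    · simpa [hk] using hF0
    · obtain rfl : k = 0 := by omega
      simp [hG0, ← hFk, hF0]
  · rw [Finset.sum_range_add]
    congr 1
    · refine Finset.sum_congr rfl fun r hr => ?_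
      have hr' := Finset.mem_range.1 hr
      by_cases h : r + 1 < k
      · simp [h, hr']
      · have : r + 1 = k := by omega
        simp [this, hr', hG0, hFk]
    · refine Finset.sum_congr rfl fun r _ => ?_
      simp [show ¬ (k + r + 1 < k) by omega, show k + r + 1 - k = r + 1 by omega]

theorem exists_classDist_lower [Finite M] :
    ∃ δ : ℝ, 0 < δ ∧ ∀ U V : QSpace s, U ≠ V → δ ≤ classDist U V := by
  obtain ⟨δ, hδ, h⟩ : ∃ δ : ℝ, 0 < δ ∧ ∀ x y : M, x ≠ y → δ ≤ dist x y := by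
    classical
    have := Fintype.ofFinite M
    by_cases hne : (Finset.univ : Finset M).offDiag.Nonempty
    · obtain ⟨p, hp, hmin⟩ := Finset.exists_min_image _ (fun p : M × M => dist p.1 p.2) hne
      refine ⟨dist p.1 p.2, dist_pos.2 (by simpa using hp), fun x y hxy => ?_⟩
      exact hmin (x, y) (by simpa using hxy)
    · refine ⟨1, one_pos, fun x y hxy => ?_⟩
      exact absurd ⟨(x, y), by simpa using hxy⟩ hne
  refine ⟨δ, hδ, fun U V hUV => ?_⟩
  apply le_csInf
  · obtain ⟨u, hu⟩ := exists_rep U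
    obtain ⟨v, hv⟩ := exists_rep V
    exact ⟨_, u, v, hu, hv, rfl⟩
  · rintro _ ⟨u, v, rfl, rfl, rfl⟩
    exact h u v fun huv => hUV (by rw [huv])

/-- For finite `M`, the Q space is a metric space with the geodesic distance. -/
instance [Finite M] : MetricSpace (QSpace s) where
  dist := geoDist
  dist_self U := le_antisymm
    (csInf_le (chainLengths_bddBelow U U) ⟨0, fun _ => U, rfl, rfl, by simp⟩)
    (Real.sInf_nonneg fun _ h => chainLengths_nonneg h)
  dist_comm U W := by
    show sInf _ = sInf _
    congr 1
    ext l
    exact ⟨chainLengths_symm, chainLengths_symm⟩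
  dist_triangle U V W := by
    show sInf _ ≤ sInf _ + sInf _
    rw [← csInf_add (chainLengths_nonempty U V) (chainLengths_bddBelow U V)
      (chainLengths_nonempty V W) (chainLengths_bddBelow V W)]
    apply csInf_le_csInf (chainLengths_bddBelow U W)
      ((chainLengths_nonempty U V).add (chainLengths_nonempty V W))
    rintro _ ⟨a, ha, b, hb, rfl⟩
    exact chainLengths_add ha hb
  eq_of_dist_eq_zero {U W} h := by
    by_contra hUW
    obtain ⟨δ, hδ, hlow⟩ := exists_classDist_lower (s := s)
    have : δ ≤ sInf (chainLengths U W) := by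
      apply le_csInf (chainLengths_nonempty U W)
      rintro _ ⟨k, V, h0, hk, rfl⟩
      obtain ⟨r, hr, hne⟩ : ∃ r, r < k ∧ V (r + 1) ≠ V r := by
        by_contra! hcon
        have : ∀ j, j ≤ k → V j = V 0 := by
          intro j
          induction j with
          | zero => simp
          | succ j ih => intro hj; rw [hcon j (by omega), ih (by omega)]
        exact hUW (by rw [← h0, ← hk, this k le_rfl])
      exact (hlow _ _ hne).trans (Finset.single_le_sum
        (f := fun r => classDist (V (r + 1)) (V r))
        (fun r _ => classDist_nonneg _ _) (Finset.mem_range.2 hr))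
    have h' : sInf (chainLengths U W) = 0 := h
    linarith

end QSpace

/-- The integers `m` such that every `n`-point metric space has a Q space of size `m` that
`α`-embeds in `X`. -/
def qSizes (X : Type*) [MetricSpace X] (α : ℝ) (n : ℕ) : Set ℕ :=
  {m : ℕ | ∀ (M : Type) [MetricSpace M] [Finite M], Nat.card M = n →
    ∃ s : Setoid M, Nat.card (QSpace s) = m ∧ AlphaEmbeds α (QSpace s) X}

/-- The Q-function `Q_X(α, n)` of a metric space `X`: the largest integer `m` such that every
`n`-point metric space has a Q space of size `m` that `α`-embeds in `X`. -/
def qFunction (X : Type*) [MetricSpace X] (α : ℝ) (n : ℕ) : ℕ := sSup (qSizes X α n)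

theorem qSizes_le {X : Type*} [MetricSpace X] {α : ℝ} {n m : ℕ} (hm : m ∈ qSizes X α n) :
    m ≤ n := by
  let _ : MetricSpace (Fin n) :=
    MetricSpace.induced (fun i : Fin n => ((i : ℕ) : ℝ))
      (fun i j h => Fin.ext (Nat.cast_injective (R := ℝ) h)) inferInstance
  obtain ⟨s, rfl, -⟩ := hm (Fin n) (by simp)
  have := Nat.card_le_card_of_surjective (QSpace.mk s) QSpace.exists_rep
  simpa using this

/-- For `n ≥ 1` (and `X` nonempty) the largest integer in the definition of `qFunction` exists. -/
theorem isGreatest_qFunction (X : Type*) [MetricSpace X] [Nonempty X] (α : ℝ) {n : ℕ}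
    (hn : 1 ≤ n) : IsGreatest (qSizes X α n) (qFunction X α n) := by
  have hb : BddAbove (qSizes X α n) := ⟨n, fun _ h => qSizes_le h⟩
  refine ⟨Nat.sSup_mem ⟨1, ?_⟩ hb, fun m hm => le_csSup hb hm⟩
  intro M _ _ hM
  have : Nonempty M := (Nat.card_pos_iff.1 (by omega)).1
  have hs : Subsingleton (QSpace (⊤ : Setoid M)) :=
    ⟨fun a b => by
      obtain ⟨x, rfl⟩ := a.exists_rep
      obtain ⟨y, rfl⟩ := b.exists_rep
      exact Quotient.sound trivial⟩
  have hne : Nonempty (QSpace (⊤ : Setoid M)) := this.map (QSpace.mk ⊤)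
  refine ⟨⊤, Nat.card_eq_one_iff_unique.2 ⟨hs, hne⟩, ?_⟩
  obtain ⟨x₀⟩ := ‹Nonempty X›
  refine (iInf_le _ ⟨fun _ => x₀, fun a b _ => Subsingleton.elim a b⟩).trans ?_
  have hz : ∀ x y : QSpace (⊤ : Setoid M), ¬ x ≠ y := fun x y h => h (Subsingleton.elim x y)
  simp [distortion, hz]

/-- Hilbert space `ℓ_2` of real square-summable sequences. -/
abbrev HilbertL2 : Type := lp (fun _ : ℕ => ℝ) 2

/-- `Q_2(α, n)`: the Q-function of `ℓ_2`. -/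
def Q₂ (α : ℝ) (n : ℕ) : ℕ := qFunction HilbertL2 α n

end

end MetricQuotient

/-!
The three regimes come from three kinds of quotients and three families of metric spaces.

**Large quotients.** Let `S` be a set of points, none of which has its nearest neighbor in `S`;
since the nearest-neighbor graph is the graph of a self-map, a third of the space can be reached
(`exists_independent_of_map`). Collapse everything outside some disjoint subsets of `S`, the petals,
to a single class, the center. The petal `i` is nowhere closer than to the center, at distance
`w i`, so the quotient distance of two petals lies between `max (w i) (w j)` and `w i + w j`. Send
the petal `i` to `w i` times a basis vector and the center to `0`: the image distance is
`√(w i ^ 2 + w j ^ 2)`, and the distortion is at most `2`. This is the linear bound for `2 ≤ α`.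
For `√2 < α` either there are many points with very different weights, and then all these
quantities nearly coincide (`exists_setoid_of_lacunary`), or there are many points with nearly the
same weight `t` (`exists_setoid_of_same_scale`). In the second case call two points adjacent if
their distance is below `√2 * t`. Either there is a large independent set, or successive maximal
independent sets form many petals that are pairwise adjacent; so the distances of the petals all
lie on the same side of `√2 * t`, which reduces the distortion to about `√2`. The loss is only
polynomial.

**Upper bounds.** Every Q space of the star `K_{1,n-1}` is again a star, and stars have distortion
tending to `√2` (`card_le_of_star`). For `α < 2` take the metric with values `1` and `2` of a
quasirandom graph on a plane over a finite field. Among the small classes of a large Q space,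
most pairs are still at distance `2`, while by the spectral gap the edges between representatives
see the same average squared distance as all pairs, so the distortion is nearly `2`
(`small_classes_le`). For arbitrary `α` take a union of many copies of a fixed Hamming cube far from
each other: a Q space that is too large contains an intact copy, whose distortion is large by
Enflo's inequality (`Q₂_le_of_cubes`).
-/

namespace MetricQuotient

/-! ### Distortion in terms of real inequalities -/

theorem AlphaEmbeds.mono {α β : ℝ} {M X : Type*} [MetricSpace M] [MetricSpace X]
    (h : AlphaEmbeds α M X) (hαβ : α ≤ β) : AlphaEmbeds β M X :=
  le_trans h (ENNReal.ofReal_le_ofReal hαβ)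

theorem alphaEmbeds_of_bilipschitz {M X : Type*} [MetricSpace M] [MetricSpace X] (f : M → X)
    {a b : ℝ} (ha : 0 < a) (hb : 0 < b) (hlo : ∀ x y, a * dist (f x) (f y) ≤ dist x y)
    (hup : ∀ x y, dist x y ≤ b * dist (f x) (f y)) : AlphaEmbeds (b / a) M X := by
  have hf : Function.Injective f := fun x y hxy => by
    have := hup x y
    rw [hxy, dist_self, mul_zero] at this
    exact dist_le_zero.1 this
  refine (iInf_le _ ⟨f, hf⟩).trans ?_
  rw [div_eq_inv_mul, ENNReal.ofReal_mul (inv_nonneg.2 ha.le)]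
  refine mul_le_mul' ?_ ?_
  · refine iSup_le fun x => iSup_le fun y => iSup_le fun hxy => ?_
    refine ENNReal.div_le_of_le_mul ?_
    rw [edist_dist, edist_dist, ← ENNReal.ofReal_mul (inv_nonneg.2 ha.le)]
    refine ENNReal.ofReal_le_ofReal ?_
    rw [le_inv_mul_iff₀ ha]
    exact hlo x y
  · refine iSup_le fun x => iSup_le fun y => iSup_le fun hxy => ?_
    refine ENNReal.div_le_of_le_mul ?_
    rw [edist_dist, edist_dist, ← ENNReal.ofReal_mul hb.le]
    exact ENNReal.ofReal_le_ofReal (hup x y)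

/-- An `α`-embeddable space has, for every `β > α`, a map whose two Lipschitz constants `b`, `e`
satisfy `b * e ≤ β`. The infimum defining the least distortion need not be attained, whence `β`. -/
theorem AlphaEmbeds.exists_lipschitz {α β : ℝ} {M X : Type*} [MetricSpace M] [MetricSpace X]
    [Nontrivial M] (h : AlphaEmbeds α M X) (hβ : 0 < β) (hαβ : α < β) :
    ∃ (f : M → X) (b e : ℝ), 0 < b ∧ 0 < e ∧ b * e ≤ β ∧
      (∀ x y, dist (f x) (f y) ≤ b * dist x y) ∧ ∀ x y, dist x y ≤ e * dist (f x) (f y) := by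
  have hlt : leastDistortion M X < ENNReal.ofReal β :=
    lt_of_le_of_lt h ((ENNReal.ofReal_lt_ofReal_iff hβ).2 hαβ)
  obtain ⟨f, hf⟩ := iInf_lt_iff.1 hlt
  unfold distortion at hf
  set s := ⨆ (x : M) (y : M) (_ : x ≠ y), edist (f x) (f y) / edist x y with hs
  set t := ⨆ (x : M) (y : M) (_ : x ≠ y), edist x y / edist (f x) (f y) with ht
  have hsle : ∀ x y, x ≠ y → edist (f x) (f y) / edist x y ≤ s := fun x y hxy =>
    le_iSup_of_le x (le_iSup_of_le y (le_iSup_of_le hxy le_rfl))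
  have htle : ∀ x y, x ≠ y → edist x y / edist (f x) (f y) ≤ t := fun x y hxy =>
    le_iSup_of_le x (le_iSup_of_le y (le_iSup_of_le hxy le_rfl))
  obtain ⟨x₀, y₀, hxy₀⟩ := exists_pair_ne M
  have hs0 : s ≠ 0 := by
    refine ne_of_gt (lt_of_lt_of_le ?_ (hsle x₀ y₀ hxy₀))
    exact ENNReal.div_pos (edist_pos.2 (f.injective.ne hxy₀)).ne' (edist_ne_top _ _)
  have ht0 : t ≠ 0 := by
    refine ne_of_gt (lt_of_lt_of_le ?_ (htle x₀ y₀ hxy₀))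
    exact ENNReal.div_pos (edist_pos.2 hxy₀).ne' (edist_ne_top _ _)
  have hst : s * t ≠ ⊤ := (hf.trans ENNReal.ofReal_lt_top).ne
  have hsT : s ≠ ⊤ := fun h' => hst (by rw [h', ENNReal.top_mul ht0])
  have htT : t ≠ ⊤ := fun h' => hst (by rw [h', ENNReal.mul_top hs0])
  refine ⟨f, s.toReal, t.toReal, ENNReal.toReal_pos hs0 hsT, ENNReal.toReal_pos ht0 htT, ?_, ?_, ?_⟩
  · rw [← ENNReal.toReal_mul]
    exact ENNReal.toReal_le_of_le_ofReal hβ.le hf.le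
  · intro x y
    rcases eq_or_ne x y with rfl | hxy
    · simp
    have h1 := hsle x y hxy
    rw [ENNReal.div_le_iff (edist_pos.2 hxy).ne' (edist_ne_top _ _)] at h1
    have := ENNReal.toReal_mono (ENNReal.mul_ne_top hsT (edist_ne_top _ _)) h1
    rwa [ENNReal.toReal_mul, edist_dist, edist_dist, ENNReal.toReal_ofReal dist_nonneg,
      ENNReal.toReal_ofReal dist_nonneg] at this
  · intro x y
    rcases eq_or_ne x y with rfl | hxy
    · simp
    have h1 := htle x y hxy
    rw [ENNReal.div_le_iff (edist_pos.2 (f.injective.ne hxy)).ne' (edist_ne_top _ _)] at h1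
    have := ENNReal.toReal_mono (ENNReal.mul_ne_top htT (edist_ne_top _ _)) h1
    rwa [ENNReal.toReal_mul, edist_dist, edist_dist, ENNReal.toReal_ofReal dist_nonneg,
      ENNReal.toReal_ofReal dist_nonneg] at this

/-- Scaled orthogonal vectors as an embedding: if all distances in `Q` are comparable to
`√(w x ^ 2 + w y ^ 2)`, then `x ↦ w x • e_x` has small distortion. -/
theorem alphaEmbeds_of_sqrt_weights {Q : Type*} [MetricSpace Q] [Finite Q] (w : Q → ℝ)
    {a b : ℝ} (ha : 0 < a) (hb : 0 < b)
    (hlo : ∀ x y, x ≠ y → a * √(w x ^ 2 + w y ^ 2) ≤ dist x y)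
    (hup : ∀ x y, x ≠ y → dist x y ≤ b * √(w x ^ 2 + w y ^ 2)) :
    AlphaEmbeds (b / a) Q HilbertL2 := by
  obtain ⟨k, ⟨σ⟩⟩ := Finite.exists_equiv_fin Q
  set f : Q → HilbertL2 := fun x => lp.single 2 ((σ x : Fin k) : ℕ) (w x) with hf
  have key : ∀ x y, x ≠ y → dist (f x) (f y) = √(w x ^ 2 + w y ^ 2) := by
    intro x y hxy
    have hne : ((σ x : Fin k) : ℕ) ≠ ((σ y : Fin k) : ℕ) := fun h =>
      hxy (σ.injective (Fin.ext h))
    have hin : inner ℝ (f x) (f y) = 0 := by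
      simp only [hf]
      rw [lp.inner_single_left, lp.single_apply_ne _ _ _ hne, inner_zero_right]
    rw [dist_eq_norm, eq_comm, Real.sqrt_eq_iff_mul_self_eq (by positivity) (norm_nonneg _),
      ← sq, ← real_inner_self_eq_norm_sq, inner_sub_left, inner_sub_right, inner_sub_right,
      real_inner_comm (f x) (f y), hin, real_inner_self_eq_norm_sq, real_inner_self_eq_norm_sq]
    simp only [hf]
    rw [lp.norm_single (by norm_num), lp.norm_single (by norm_num), Real.norm_eq_abs,
      Real.norm_eq_abs, sq_abs, sq_abs]
    ring
  refine alphaEmbeds_of_bilipschitz f ha hb (fun x y => ?_) (fun x y => ?_)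
  · rcases eq_or_ne x y with rfl | hxy
    · simp
    · rw [key x y hxy]; exact hlo x y hxy
  · rcases eq_or_ne x y with rfl | hxy
    · simp
    · rw [key x y hxy]; exact hup x y hxy

/-! ### Distances in Q spaces -/

namespace QSpace

theorem mk_eq_mk {M : Type*} {s : Setoid M} {x y : M} : mk s x = mk s y ↔ s x y := Quotient.eq

variable {M : Type*} [MetricSpace M] [Finite M] {s : Setoid M}

theorem dist_mk_le (x y : M) : dist (mk s x) (mk s y) ≤ dist x y := by
  refine (csInf_le (chainLengths_bddBelow _ _)
    ⟨1, fun r => if r = 0 then mk s x else mk s y, by simp, by simp, rfl⟩).trans ?_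
  simp only [Finset.range_one, Finset.sum_singleton]
  refine csInf_le ⟨0, ?_⟩ ⟨y, x, by simp, by simp, dist_comm _ _⟩
  rintro _ ⟨u, v, -, -, rfl⟩
  exact dist_nonneg

/-- Every `1`-Lipschitz function on `M` that is constant on the classes bounds geodesic distances
from below. -/
theorem le_dist_mk (ψ : M → ℝ) (hψ : ∀ u v, ψ u - ψ v ≤ dist u v)
    (hs : ∀ u v, s u v → ψ u = ψ v) (x y : M) : ψ y - ψ x ≤ dist (mk s x) (mk s y) := by
  let φ : QSpace s → ℝ := Quotient.lift ψ hs
  have hφ : ∀ z, φ (mk s z) = ψ z := fun z => rfl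
  refine le_csInf (chainLengths_nonempty _ _) ?_
  rintro _ ⟨k, V, h0, hk, rfl⟩
  rw [← hφ, ← hφ, ← h0, ← hk, ← Finset.sum_range_sub (fun r => φ (V r))]
  refine Finset.sum_le_sum fun r _ => ?_
  refine le_csInf ?_ ?_
  · obtain ⟨u, hu⟩ := exists_rep (V (r + 1))
    obtain ⟨v, hv⟩ := exists_rep (V r)
    exact ⟨_, u, v, hu, hv, rfl⟩
  · rintro _ ⟨u, v, hu, hv, rfl⟩
    rw [← hu, ← hv, hφ, hφ]
    exact hψ u v

end QSpace

theorem le_Q₂ {α : ℝ} {n m : ℕ} (hn : 1 ≤ n) (h : m ∈ qSizes HilbertL2 α n) : m ≤ Q₂ α n :=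
  (isGreatest_qFunction HilbertL2 α hn).2 h

theorem exists_setoid_card_eq_Q₂ {α : ℝ} {n : ℕ} (hn : 1 ≤ n) (M : Type) [MetricSpace M]
    [Finite M] (hM : Nat.card M = n) :
    ∃ s : Setoid M, Nat.card (QSpace s) = Q₂ α n ∧ AlphaEmbeds α (QSpace s) HilbertL2 :=
  (isGreatest_qFunction HilbertL2 α hn).1 M hM

/-! ### Star-shaped quotients -/

/-- Suppose the level sets of `l : M → Option ι` are a center (the points labelled `none`) and
petals indexed by `ι`, where no point is nearer to the petal `i` than the center, which is at
distance `w i` from it. If the distances of the petals are comparable to `√(w i ^ 2 + w j ^ 2)`,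
either directly or through the center, then the quotient embeds well into `ℓ_2`. -/
theorem exists_setoid_of_star {M : Type*} [MetricSpace M] [Finite M] {m : ℕ}
    (l : M → Option (Fin m)) (w : Fin m → ℝ) {a b : ℝ} (ha : 0 < a) (ha1 : a ≤ 1) (hb : 1 ≤ b)
    (hc : ∃ z, l z = none)
    (hw : ∀ i, ∃ x y, l x = some i ∧ l y = none ∧ dist x y = w i)
    (hle : ∀ i x y, l x = some i → l y ≠ some i → w i ≤ dist x y)
    (hup : ∀ i j, i ≠ j → w i + w j ≤ b * √(w i ^ 2 + w j ^ 2) ∨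
      ∃ x y, l x = some i ∧ l y = some j ∧ dist x y ≤ b * √(w i ^ 2 + w j ^ 2))
    (hlo : ∀ i j, i ≠ j → ∀ x y, l x = some i → l y = some j →
      a * √(w i ^ 2 + w j ^ 2) ≤ dist x y) :
    ∃ s : Setoid M, Nat.card (QSpace s) = m + 1 ∧ AlphaEmbeds (b / a) (QSpace s) HilbertL2 := by
  set s : Setoid M := Setoid.ker l with hs
  have hsurj : Function.Surjective l := by
    rintro (_ | i)
    · exact hc
    · obtain ⟨x, -, hx, -⟩ := hw i
      exact ⟨x, hx⟩
  have hrel : ∀ x y, s x y ↔ l x = l y := fun x y => Iff.rfl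
  have hmk : ∀ x y, QSpace.mk s x = QSpace.mk s y ↔ l x = l y := fun x y => QSpace.mk_eq_mk
  have hpos : ∀ i, 0 < w i := by
    intro i
    obtain ⟨x, y, hx, hy, h⟩ := hw i
    rw [← h]
    refine dist_pos.2 fun hxy => ?_
    rw [hxy, hy] at hx
    simp at hx
  refine ⟨s, ?_, ?_⟩
  · have e : QSpace s ≃ Option (Fin m) := Setoid.quotientKerEquivOfSurjective l hsurj
    rw [Nat.card_congr e]
    simp
  let v : Option (Fin m) → ℝ := fun o => o.elim 0 w
  -- The distance of the center and a petal.
  have hcen_up : ∀ i x z, l x = some i → l z = none →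
      dist (QSpace.mk s x) (QSpace.mk s z) ≤ w i := by
    intro i x z hx hz
    obtain ⟨x', y', hx', hy', h⟩ := hw i
    rw [(hmk x x').2 (hx.trans hx'.symm), (hmk z y').2 (hz.trans hy'.symm), ← h]
    exact QSpace.dist_mk_le _ _
  have hcen_lo : ∀ i x z, l x = some i → l z = none →
      w i ≤ dist (QSpace.mk s x) (QSpace.mk s z) := by
    intro i x z hx hz
    have := QSpace.le_dist_mk (s := s) (fun u => if l u = some i then 0 else w i) ?_ ?_ x z
    · simpa [hx, hz] using this
    · intro u t
      by_cases hu : l u = some i <;> by_cases ht : l t = some i <;> simp only [hu, ht, if_true,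
        if_false, sub_self, sub_zero, zero_sub]
      · exact dist_nonneg
      · exact (neg_nonpos.2 (hpos i).le).trans dist_nonneg
      · rw [dist_comm]; exact hle i t u ht hu
      · exact dist_nonneg
    · intro u t hut
      simp only [(hrel u t).1 hut]
  -- The distance of two petals.
  have hpet_up : ∀ i j x y, i ≠ j → l x = some i → l y = some j →
      dist (QSpace.mk s x) (QSpace.mk s y) ≤ b * √(w i ^ 2 + w j ^ 2) := by
    intro i j x y hij hx hy
    rcases hup i j hij with h | ⟨x', y', hx', hy', h⟩
    · obtain ⟨z, hz⟩ := hc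
      refine (dist_triangle _ (QSpace.mk s z) _).trans (le_trans ?_ h)
      refine add_le_add (hcen_up i x z hx hz) ?_
      rw [dist_comm]
      exact hcen_up j y z hy hz
    · rw [(hmk x x').2 (hx.trans hx'.symm), (hmk y y').2 (hy.trans hy'.symm)]
      exact (QSpace.dist_mk_le _ _).trans h
  have hpet_lo : ∀ i j x y, i ≠ j → l x = some i → l y = some j →
      a * √(w i ^ 2 + w j ^ 2) ≤ dist (QSpace.mk s x) (QSpace.mk s y) := by
    intro i j x y hij hx hy
    set r := a * √(w i ^ 2 + w j ^ 2) with hr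
    have hwi := hpos i
    have hwj := hpos j
    have hr0 : 0 ≤ r := by positivity
    have hr1 : r ≤ w i + w j := by
      have : √(w i ^ 2 + w j ^ 2) ≤ w i + w j := by
        rw [Real.sqrt_le_left (by positivity)]
        nlinarith
      have h2 := Real.sqrt_nonneg (w i ^ 2 + w j ^ 2)
      nlinarith
    -- The middle value lies within `w i` of `0` and within `w j` of `r`.
    set c := max 0 (r - w j) with hcdef
    have hc0 : 0 ≤ c := le_max_left _ _
    have hc1 : r - w j ≤ c := le_max_right _ _
    have hc2 : c ≤ w i := max_le hwi.le (by linarith)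
    have hc3 : c ≤ r := max_le hr0 (by linarith)
    have := QSpace.le_dist_mk (s := s)
      (fun u => if l u = some i then 0 else if l u = some j then r else c) ?_ ?_ x y
    · have hji : ¬ j = i := fun h => hij h.symm
      simpa [hx, hy, hji] using this
    · intro u t
      have hd := dist_nonneg (x := u) (y := t)
      have hji : ¬ j = i := fun h => hij h.symm
      by_cases hu : l u = some i
      · by_cases ht : l t = some i
        · simp [hu, ht]
        · simp only [hu, ht, if_true, if_false]
          split_ifs <;> linarith
      · by_cases ht : l t = some i
        · have h1 := hle i t u ht hu
          rw [dist_comm] at h1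
          by_cases hu' : l u = some j
          · have h2 := hlo i j hij t u ht hu'
            rw [dist_comm] at h2
            simpa [hu', hji, ht] using h2
          · simp only [hu, ht, hu', if_true, if_false]
            linarith
        · by_cases hu' : l u = some j <;> by_cases ht' : l t = some j
          · simp [hu', ht']
          · have h2 := hle j u t hu' ht'
            simp only [ht, hu', ht', if_true, if_false, Option.some_inj, hji]
            linarith
          · simp only [hu, hu', ht', if_true, if_false, Option.some_inj, hji]
            linarith
          · simp [hu, ht, hu', ht']
    · intro u t hut
      simp only [(hrel u t).1 hut]
  have hb0 : (0 : ℝ) < b := by linarith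
  let W : QSpace s → ℝ := Quotient.lift (fun x => v (l x)) fun x y hxy => by
    simp only [(hrel x y).1 hxy]
  have hW : ∀ x, W (QSpace.mk s x) = v (l x) := fun x => rfl
  refine alphaEmbeds_of_sqrt_weights W ha hb0 ?_ ?_
  · intro U V hUV
    obtain ⟨x, rfl⟩ := U.exists_rep
    obtain ⟨y, rfl⟩ := V.exists_rep
    rw [hW, hW]
    have hne : l x ≠ l y := fun h => hUV ((hmk x y).2 h)
    rcases hx : l x with _ | i <;> rcases hy : l y with _ | j
    · exact absurd (hx.trans hy.symm) hne
    · have := hcen_lo j y x hy hx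
      rw [dist_comm] at this
      simp only [v, Option.elim]
      rw [zero_pow two_ne_zero, zero_add, Real.sqrt_sq (hpos j).le]
      nlinarith [hpos j]
    · have := hcen_lo i x y hx hy
      simp only [v, Option.elim]
      rw [zero_pow two_ne_zero, add_zero, Real.sqrt_sq (hpos i).le]
      nlinarith [hpos i]
    · exact hpet_lo i j x y (fun h => hne (by rw [hx, hy, h])) hx hy
  · intro U V hUV
    obtain ⟨x, rfl⟩ := U.exists_rep
    obtain ⟨y, rfl⟩ := V.exists_rep
    rw [hW, hW]
    have hne : l x ≠ l y := fun h => hUV ((hmk x y).2 h)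
    rcases hx : l x with _ | i <;> rcases hy : l y with _ | j
    · exact absurd (hx.trans hy.symm) hne
    · have := hcen_up j y x hy hx
      rw [dist_comm] at this
      simp only [v, Option.elim]
      rw [zero_pow two_ne_zero, zero_add, Real.sqrt_sq (hpos j).le]
      nlinarith [hpos j]
    · have := hcen_up i x y hx hy
      simp only [v, Option.elim]
      rw [zero_pow two_ne_zero, add_zero, Real.sqrt_sq (hpos i).le]
      nlinarith [hpos i]
    · exact hpet_up i j x y (fun h => hne (by rw [hx, hy, h])) hx hy

/-! ### Nearest neighbors and petals -/

theorem exists_nearest_neighbor (M : Type*) [MetricSpace M] [Finite M] [Nontrivial M] :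
    ∃ N : M → M, (∀ x, N x ≠ x) ∧ ∀ x y, y ≠ x → dist x (N x) ≤ dist x y := by
  have : ∀ x : M, ∃ y, y ≠ x ∧ ∀ z, z ≠ x → dist x y ≤ dist x z := by
    intro x
    obtain ⟨y, hy, hmin⟩ := Set.exists_min_image {y : M | y ≠ x} (fun y => dist x y)
      (Set.toFinite _) (exists_ne x)
    exact ⟨y, hy, hmin⟩
  choose N h1 h2 using this
  exact ⟨N, h1, h2⟩

/-- The graph of a self-map without fixed points has large independent sets, because every
induced subgraph contains a vertex of in-degree at most `1`. -/
theorem exists_independent_of_map {M : Type*} (N : M → M) (hN : ∀ x, N x ≠ x) (V : Finset M) :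
    ∃ S ⊆ V, V.card ≤ 3 * S.card ∧ ∀ x ∈ S, N x ∉ S := by
  classical
  induction V using Finset.strongInduction with
  | H V ih =>
    rcases V.eq_empty_or_nonempty with rfl | hV
    · exact ⟨∅, by simp⟩
    obtain ⟨v, hv, hcard⟩ := Finset.exists_card_fiber_le_of_card_le_mul (s := V) (t := V) (f := N)
      (n := 1) hV (by simp)
    set P := V.filter fun x => N x = v with hP
    set R : Finset M := insert v (insert (N v) P) with hR
    have hRc : R.card ≤ 3 := by
      rw [hR]
      have h1 := Finset.card_insert_le v (insert (N v) P)
      have h2 := Finset.card_insert_le (N v) P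
      omega
    have hss : V \ R ⊂ V := by
      refine Finset.ssubset_iff_subset_ne.2 ⟨Finset.sdiff_subset, fun h => ?_⟩
      rw [← h] at hv
      simp [hR] at hv
    obtain ⟨S, hSV, hSc, hS⟩ := ih (V \ R) hss
    have hvS : v ∉ S := fun h => by
      have := hSV h
      simp [hR] at this
    refine ⟨insert v S, ?_, ?_, ?_⟩
    · exact Finset.insert_subset hv (hSV.trans Finset.sdiff_subset)
    · rw [Finset.card_insert_of_notMem hvS]
      have := Finset.le_card_sdiff R V
      omega
    · intro x hx
      rcases Finset.mem_insert.1 hx with rfl | hx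
      · intro h
        rcases Finset.mem_insert.1 h with h | h
        · exact hN _ h
        · have := hSV h
          simp [hR] at this
      · intro h
        rcases Finset.mem_insert.1 h with h | h
        · have := hSV hx
          simp only [hR, hP, Finset.mem_sdiff, Finset.mem_insert, Finset.mem_filter] at this
          tauto
        · exact hS x hx h

/-- Petals inside a set `S` which contains the nearest neighbor of none of its points: the center
is the complement of the petals, and the weight of a petal is the least distance of one of its
points to its nearest neighbor. -/
theorem exists_setoid_of_petals {M : Type*} [MetricSpace M] [Finite M] [Nonempty M] {N : M → M}
    (hmin : ∀ x y, y ≠ x → dist x (N x) ≤ dist x y) {S : Finset M}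
    (hS : ∀ x ∈ S, N x ∉ S) {m : ℕ} (F : Fin m → Finset M) (w : Fin m → ℝ) {a b : ℝ}
    (ha : 0 < a) (ha1 : a ≤ 1) (hb : 1 ≤ b) (hFS : ∀ i, F i ⊆ S)
    (hF : ∀ i j, i ≠ j → Disjoint (F i) (F j)) (hw : ∀ i, ∃ x ∈ F i, dist x (N x) = w i)
    (hle : ∀ i, ∀ x ∈ F i, w i ≤ dist x (N x))
    (hup : ∀ i j, i ≠ j → w i + w j ≤ b * √(w i ^ 2 + w j ^ 2) ∨
      ∃ x ∈ F i, ∃ y ∈ F j, dist x y ≤ b * √(w i ^ 2 + w j ^ 2))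
    (hlo : ∀ i j, i ≠ j → ∀ x ∈ F i, ∀ y ∈ F j, a * √(w i ^ 2 + w j ^ 2) ≤ dist x y) :
    ∃ s : Setoid M, Nat.card (QSpace s) = m + 1 ∧ AlphaEmbeds (b / a) (QSpace s) HilbertL2 := by
  classical
  let l : M → Option (Fin m) := fun x => if h : ∃ i, x ∈ F i then some h.choose else none
  have hsome : ∀ x i, l x = some i ↔ x ∈ F i := by
    intro x i
    constructor
    · intro h
      by_cases hx : ∃ i, x ∈ F i
      · have := hx.choose_spec
        simp only [l, dif_pos hx, Option.some_inj] at h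
        rwa [h] at this
      · simp [l, dif_neg hx] at h
    · intro h
      have hx : ∃ i, x ∈ F i := ⟨i, h⟩
      simp only [l, dif_pos hx, Option.some_inj]
      by_contra hne
      exact Finset.disjoint_left.1 (hF _ _ hne) hx.choose_spec h
  have hnone : ∀ x, x ∉ S → l x = none := by
    intro x hx
    have : ¬ ∃ i, x ∈ F i := fun ⟨i, hi⟩ => hx (hFS i hi)
    simp [l, dif_neg this]
  refine exists_setoid_of_star l w ha ha1 hb ?_ ?_ ?_ ?_ ?_
  · obtain ⟨x⟩ := ‹Nonempty M›
    by_cases hx : x ∈ S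
    · exact ⟨N x, hnone _ (hS x hx)⟩
    · exact ⟨x, hnone x hx⟩
  · intro i
    obtain ⟨x, hx, h⟩ := hw i
    exact ⟨x, N x, (hsome x i).2 hx, hnone _ (hS x (hFS i hx)), h⟩
  · intro i x y hx hy
    have hx' := (hsome x i).1 hx
    exact (hle i x hx').trans (hmin x y fun h => hy (h ▸ hx))
  · intro i j hij
    rcases hup i j hij with h | ⟨x, hx, y, hy, h⟩
    · exact Or.inl h
    · exact Or.inr ⟨x, y, (hsome x i).2 hx, (hsome y j).2 hy, h⟩
  · intro i j hij x y hx hy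
    exact hlo i j hij x ((hsome x i).1 hx) y ((hsome y j).1 hy)

/-- The case of `exists_setoid_of_petals` in which every petal is a single point. -/
theorem exists_setoid_of_points {M : Type*} [MetricSpace M] [Finite M] [Nonempty M] {N : M → M}
    (hmin : ∀ x y, y ≠ x → dist x (N x) ≤ dist x y) {S : Finset M}
    (hS : ∀ x ∈ S, N x ∉ S) {m : ℕ} (x : Fin m → M) (hx : Function.Injective x)
    (hxS : ∀ i, x i ∈ S) {a b : ℝ} (ha : 0 < a) (ha1 : a ≤ 1) (hb : 1 ≤ b)
    (hup : ∀ i j, i ≠ j → dist (x i) (N (x i)) + dist (x j) (N (x j)) ≤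
      b * √(dist (x i) (N (x i)) ^ 2 + dist (x j) (N (x j)) ^ 2))
    (hlo : ∀ i j, i ≠ j →
      a * √(dist (x i) (N (x i)) ^ 2 + dist (x j) (N (x j)) ^ 2) ≤ dist (x i) (x j)) :
    ∃ s : Setoid M, Nat.card (QSpace s) = m + 1 ∧ AlphaEmbeds (b / a) (QSpace s) HilbertL2 := by
  refine exists_setoid_of_petals hmin hS (fun i => {x i}) (fun i => dist (x i) (N (x i)))
    ha ha1 hb ?_ ?_ ?_ ?_ ?_ ?_
  · intro i
    simpa using hxS i
  · intro i j hij
    simpa using hx.ne hij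
  · intro i
    simp
  · intro i
    simp
  · exact fun i j hij => Or.inl (hup i j hij)
  · intro i j hij
    simpa using hlo i j hij

theorem add_le_sqrt_two_mul_sqrt {u v : ℝ} : u + v ≤ √2 * √(u ^ 2 + v ^ 2) := by
  rw [← Real.sqrt_mul (by norm_num)]
  refine Real.le_sqrt_of_sq_le ?_
  nlinarith [sq_nonneg (u - v)]

theorem inv_sqrt_two_mul_sqrt_le {u v d : ℝ} (hu : 0 ≤ u) (hv : 0 ≤ v) (hud : u ≤ d)
    (hvd : v ≤ d) : (√2)⁻¹ * √(u ^ 2 + v ^ 2) ≤ d := by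
  have h2 : (0 : ℝ) < √2 := by positivity
  rw [inv_mul_le_iff₀ h2, Real.sqrt_le_left (by nlinarith), mul_pow, Real.sq_sqrt (by norm_num)]
  nlinarith

theorem inv_sqrt_two_le_one : (√2 : ℝ)⁻¹ ≤ 1 :=
  inv_le_one_of_one_le₀ (Real.one_le_sqrt.2 (by norm_num))

/-- For `α ≥ 2` all points of `S` can be kept as singletons. -/
theorem div_three_add_one_mem_qSizes {α : ℝ} (hα : 2 ≤ α) {n : ℕ} (hn : 2 ≤ n) :
    n / 3 + 1 ∈ qSizes HilbertL2 α n := by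
  intro M _ _ hM
  have := Fintype.ofFinite M
  rw [Nat.card_eq_fintype_card] at hM
  have : Nontrivial M := Fintype.one_lt_card_iff_nontrivial.1 (by omega)
  obtain ⟨N, hN, hmin⟩ := exists_nearest_neighbor M
  obtain ⟨S, -, hSc, hS⟩ := exists_independent_of_map N hN Finset.univ
  rw [Finset.card_univ, hM] at hSc
  obtain ⟨T, hTS, hT⟩ := Finset.exists_subset_card_eq (show n / 3 ≤ S.card by omega)
  let e := (T.equivFinOfCardEq hT).symm
  have hsq : √2 * √2 = (2 : ℝ) := Real.mul_self_sqrt (by norm_num)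
  obtain ⟨s, hs, hemb⟩ := exists_setoid_of_points hmin hS (fun i => (e i : M))
    (Subtype.val_injective.comp e.injective) (fun i => hTS (e i).2) (a := (√2)⁻¹) (b := √2)
    (by positivity) inv_sqrt_two_le_one (Real.one_le_sqrt.2 (by norm_num))
    (fun i j _ => add_le_sqrt_two_mul_sqrt) (fun i j hij => by
      have hne : (e i : M) ≠ e j := (Subtype.val_injective.comp e.injective).ne hij
      refine inv_sqrt_two_mul_sqrt_le dist_nonneg dist_nonneg (hmin _ _ hne.symm) ?_
      rw [dist_comm (e i : M) (e j)]
      exact hmin _ _ hne)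
  refine ⟨s, hs, hemb.mono ?_⟩
  rw [div_inv_eq_mul, hsq]
  exact hα

/-! ### Petals for distortion between `√2` and `2` -/

/-- If a graph has no independent set of size `a`, then successive maximal independent sets,
each of which dominates the vertices remaining after it, are pairwise adjacent. -/
theorem exists_independent_or_adjacent {V : Type*} (r : V → V → Prop) (hr : ∀ x y, r x y → r y x)
    {a : ℕ} (ha : 0 < a) (b : ℕ) (K : Finset V) (hK : a * b ≤ K.card) :
    (∃ I ⊆ K, I.card = a ∧ ∀ x ∈ I, ∀ y ∈ I, x ≠ y → ¬ r x y) ∨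
    ∃ F : ℕ → Finset V, (∀ i < b, (F i).Nonempty ∧ F i ⊆ K) ∧
      ∀ i < b, ∀ j < b, i ≠ j → Disjoint (F i) (F j) ∧ ∃ x ∈ F i, ∃ y ∈ F j, r x y := by
  classical
  induction b generalizing K with
  | zero => exact Or.inr ⟨fun _ => ∅, by simp⟩
  | succ b ih =>
    have hne : (K.powerset.filter fun I => ∀ x ∈ I, ∀ y ∈ I, x ≠ y → ¬ r x y).Nonempty :=
      ⟨∅, by simp⟩
    obtain ⟨I, hI⟩ := Finset.exists_maximal hne
    have hIm := hI.prop
    simp only [Finset.mem_filter, Finset.mem_powerset] at hIm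
    obtain ⟨hIK, hind⟩ := hIm
    -- By maximality every vertex outside `I` has a neighbor in `I`.
    have hdom : ∀ y ∈ K, y ∉ I → ∃ x ∈ I, r x y := by
      intro y hy hyI
      by_contra! hcon
      refine hyI (hI.le_of_ge (y := insert y I) ?_ (Finset.subset_insert _ _)
        (Finset.mem_insert_self _ _))
      simp only [Finset.mem_filter, Finset.mem_powerset]
      refine ⟨Finset.insert_subset hy hIK, fun u hu v hv huv => ?_⟩
      rcases Finset.mem_insert.1 hu with rfl | hu' <;>
        rcases Finset.mem_insert.1 hv with rfl | hv'
      · exact absurd rfl huv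
      · exact fun h => hcon v hv' (hr _ _ h)
      · exact hcon u hu'
      · exact hind u hu' v hv' huv
    by_cases hc : a ≤ I.card
    · obtain ⟨J, hJI, hJ⟩ := Finset.exists_subset_card_eq hc
      exact Or.inl ⟨J, hJI.trans hIK, hJ, fun x hx y hy => hind x (hJI hx) y (hJI hy)⟩
    have hInz : I.Nonempty := by
      by_contra hI0
      rw [Finset.not_nonempty_iff_eq_empty] at hI0
      have : 0 < K.card := lt_of_lt_of_le (by positivity) hK
      obtain ⟨y, hy⟩ := Finset.card_pos.1 this
      obtain ⟨x, hx, -⟩ := hdom y hy (by simp [hI0])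
      simp [hI0] at hx
    have hcard : a * b ≤ (K \ I).card := by
      rw [Finset.card_sdiff_of_subset hIK]
      have : a * (b + 1) = a * b + a := by ring
      omega
    rcases ih (K \ I) hcard with ⟨J, hJ, h⟩ | ⟨F, hF1, hF2⟩
    · exact Or.inl ⟨J, hJ.trans Finset.sdiff_subset, h⟩
    have hnew : ∀ i < b, Disjoint I (F i) ∧ ∃ x ∈ I, ∃ y ∈ F i, r x y := by
      intro i hi
      obtain ⟨⟨y, hy⟩, hsub⟩ := hF1 i hi
      have hyK := Finset.mem_sdiff.1 (hsub hy)
      obtain ⟨x, hx, hxy⟩ := hdom y hyK.1 hyK.2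
      exact ⟨(Finset.disjoint_sdiff).mono_right hsub, x, hx, y, hy, hxy⟩
    refine Or.inr ⟨fun i => if i = b then I else F i, fun i hi => ?_, fun i hi j hj hij => ?_⟩
    · by_cases hib : i = b
      · simp [hib, hInz, hIK]
      · have := hF1 i (by omega)
        simp only [hib, if_false]
        exact ⟨this.1, this.2.trans Finset.sdiff_subset⟩
    · by_cases hib : i = b <;> by_cases hjb : j = b
      · omega
      · simp only [hib, hjb, if_true, if_false]
        exact hnew j (by omega)
      · simp only [hib, hjb, if_true, if_false]
        obtain ⟨h1, x, hx, y, hy, hxy⟩ := hnew i (by omega)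
        exact ⟨h1.symm, y, hy, x, hx, hr _ _ hxy⟩
      · simp only [hib, hjb, if_false]
        exact hF2 i (by omega) j (by omega) hij

/-- Points whose nearest-neighbor distances differ by a factor of at most `θ`: compare distances
with `√2` times the least nearest-neighbor distance `t`. Pairwise distances at least `√2 * t` give
single points as petals, while sets with pairwise distances below `√2 * t` give larger petals. -/
theorem exists_setoid_of_same_scale {M : Type*} [MetricSpace M] [Finite M] [Nonempty M]
    {N : M → M} (hmin : ∀ x y, y ≠ x → dist x (N x) ≤ dist x y)
    {S : Finset M} (hS : ∀ x ∈ S, N x ∉ S) {m : ℕ} (hm : 0 < m) {K : Finset M} (hKS : K ⊆ S)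
    (hK : m * m ≤ K.card) {θ : ℝ} (hθ : 1 ≤ θ)
    (hscale : ∀ x ∈ K, ∀ y ∈ K, dist x (N x) ≤ θ * dist y (N y)) :
    ∃ s : Setoid M, Nat.card (QSpace s) = m + 1 ∧ AlphaEmbeds (√2 * θ) (QSpace s) HilbertL2 := by
  classical
  have hs2 : (0 : ℝ) < √2 := by positivity
  obtain ⟨x₀, hx₀, hx₀min⟩ := Finset.exists_min_image K (fun x => dist x (N x))
    (Finset.card_pos.1 (lt_of_lt_of_le (by positivity) hK))
  set t := dist x₀ (N x₀) with ht
  have ht0 : 0 ≤ t := dist_nonneg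
  rcases exists_independent_or_adjacent (fun x y => dist x y < √2 * t)
    (fun x y h => by rwa [dist_comm]) hm m K hK with ⟨I, hIK, hIm, hI⟩ | ⟨F, hF1, hF2⟩
  · let e := (I.equivFinOfCardEq hIm).symm
    obtain ⟨s, hs, hemb⟩ := exists_setoid_of_points hmin hS (fun i => (e i : M))
      (Subtype.val_injective.comp e.injective) (fun i => hKS (hIK (e i).2)) (a := θ⁻¹) (b := √2)
      (by positivity) (inv_le_one_of_one_le₀ hθ) (Real.one_le_sqrt.2 (by norm_num))
      (fun i j _ => add_le_sqrt_two_mul_sqrt) (fun i j hij => by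
        have hne : (e i : M) ≠ e j := (Subtype.val_injective.comp e.injective).ne hij
        have hd := not_lt.1 (hI _ (e i).2 _ (e j).2 hne)
        refine le_trans ?_ hd
        have h1 := hscale _ (hIK (e i).2) _ hx₀
        have h2 := hscale _ (hIK (e j).2) _ hx₀
        rw [inv_mul_le_iff₀ (by positivity), Real.sqrt_le_left (by positivity), mul_pow, mul_pow,
          Real.sq_sqrt (by norm_num)]
        have h3 := pow_le_pow_left₀ dist_nonneg h1 2
        have h4 := pow_le_pow_left₀ dist_nonneg h2 2
        rw [mul_pow, ← ht] at h3 h4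
        linarith)
    exact ⟨s, hs, hemb.mono (by rw [div_inv_eq_mul])⟩
  · have hmw : ∀ i : Fin m, ∃ x ∈ F i, ∀ y ∈ F i, dist x (N x) ≤ dist y (N y) := fun i =>
      Finset.exists_min_image (F i) (fun x => dist x (N x)) (hF1 i i.2).1
    choose x hx hxmin using hmw
    have hxt : ∀ i, t ≤ dist (x i) (N (x i)) := fun i => hx₀min _ ((hF1 i i.2).2 (hx i))
    obtain ⟨s, hs, hemb⟩ := exists_setoid_of_petals hmin hS (fun i : Fin m => F i)
      (fun i => dist (x i) (N (x i))) (a := (√2)⁻¹) (b := 1) (by positivity) inv_sqrt_two_le_one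
      le_rfl (fun i => (hF1 i i.2).2.trans hKS)
      (fun i j hij => (hF2 i i.2 j j.2 (fun h => hij (Fin.ext h))).1)
      (fun i => ⟨x i, hx i, rfl⟩) (fun i y hy => hxmin i y hy)
      (fun i j hij => by
        obtain ⟨-, y, hy, z, hz, hyz⟩ := hF2 i i.2 j j.2 (fun h => hij (Fin.ext h))
        refine Or.inr ⟨y, hy, z, hz, hyz.le.trans ?_⟩
        rw [one_mul]
        refine Real.le_sqrt_of_sq_le ?_
        rw [mul_pow, Real.sq_sqrt (by norm_num)]
        nlinarith [hxt i, hxt j])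
      (fun i j hij y hy z hz => by
        have hne : y ≠ z := fun h => Finset.disjoint_left.1
          (hF2 i i.2 j j.2 (fun h => hij (Fin.ext h))).1 hy (h ▸ hz)
        refine inv_sqrt_two_mul_sqrt_le dist_nonneg dist_nonneg
          ((hxmin i y hy).trans (hmin _ _ hne.symm)) ((hxmin j z hz).trans ?_)
        rw [dist_comm y z]
        exact hmin _ _ hne)
    refine ⟨s, hs, hemb.mono ?_⟩
    rw [div_inv_eq_mul, one_mul]
    nlinarith

/-- Points whose nearest-neighbor distances are very different: each distance in the quotient
is close to the larger of the two weights. -/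
theorem exists_setoid_of_lacunary {M : Type*} [MetricSpace M] [Finite M] [Nonempty M]
    {N : M → M} (hmin : ∀ x y, y ≠ x → dist x (N x) ≤ dist x y)
    {S : Finset M} (hS : ∀ x ∈ S, N x ∉ S) {m : ℕ} (x : Fin m → M) (hx : Function.Injective x)
    (hxS : ∀ i, x i ∈ S) {θ : ℝ} (hθ : 1 < θ)
    (hlac : ∀ i j, i ≠ j → dist (x i) (N (x i)) ≤ (θ - 1) * dist (x j) (N (x j)) ∨
      dist (x j) (N (x j)) ≤ (θ - 1) * dist (x i) (N (x i))) :
    ∃ s : Setoid M, Nat.card (QSpace s) = m + 1 ∧ AlphaEmbeds (θ ^ 2) (QSpace s) HilbertL2 := by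
  have hup : ∀ u v : ℝ, 0 ≤ u → 0 ≤ v → (u ≤ (θ - 1) * v ∨ v ≤ (θ - 1) * u) →
      u + v ≤ θ * √(u ^ 2 + v ^ 2) := by
    intro u v hu hv h
    have h1 : u ≤ √(u ^ 2 + v ^ 2) := Real.le_sqrt_of_sq_le (by nlinarith)
    have h2 : v ≤ √(u ^ 2 + v ^ 2) := Real.le_sqrt_of_sq_le (by nlinarith)
    rcases h with h | h <;> nlinarith
  have hlo : ∀ u v d : ℝ, 0 ≤ u → 0 ≤ v → u ≤ d → v ≤ d →
      (u ≤ (θ - 1) * v ∨ v ≤ (θ - 1) * u) → θ⁻¹ * √(u ^ 2 + v ^ 2) ≤ d := by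
    intro u v d hu hv hud hvd h
    have h1 : √(u ^ 2 + v ^ 2) ≤ u + v := by
      rw [Real.sqrt_le_left (by positivity)]
      nlinarith
    rw [inv_mul_le_iff₀ (by positivity)]
    rcases h with h | h <;> nlinarith
  obtain ⟨s, hs, hemb⟩ := exists_setoid_of_points hmin hS x hx hxS (a := θ⁻¹) (b := θ)
    (by positivity) (inv_le_one_of_one_le₀ hθ.le) hθ.le
    (fun i j hij => hup _ _ dist_nonneg dist_nonneg (hlac i j hij))
    (fun i j hij => by
      refine hlo _ _ _ dist_nonneg dist_nonneg (hmin _ _ (hx.ne hij).symm) ?_ (hlac i j hij)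
      rw [dist_comm (x i) (x j)]
      exact hmin _ _ (hx.ne hij))
  exact ⟨s, hs, hemb.mono (by rw [div_inv_eq_mul, sq])⟩

/-- Sort the points by `⌊log_θ⌋` of their nearest-neighbor distance, and keep one residue class
modulo `L` of these integers: either one value is taken often, or many values are taken, and then
they are at least `L` apart. -/
theorem exists_add_one_mem_qSizes {α : ℝ} (hα : √2 < α) :
    ∃ L : ℕ, 0 < L ∧ ∀ n m : ℕ, 0 < m → 3 * (L * m ^ 3) ≤ n → m + 1 ∈ qSizes HilbertL2 α n := by
  classical
  have hs2 : (0 : ℝ) < √2 := by positivity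
  have hs21 : (1 : ℝ) < √2 := by
    rw [Real.lt_sqrt (by norm_num)]; norm_num
  set θ := min (α / √2) √α with hθdef
  have hθ : 1 < θ := lt_min (by rwa [one_lt_div hs2])
    (by rw [Real.lt_sqrt (by norm_num)]; linarith)
  have hθ1 : √2 * θ ≤ α := by
    have := min_le_left (α / √2) √α
    rwa [← hθdef, le_div_iff₀ hs2, mul_comm] at this
  have hθ2 : θ ^ 2 ≤ α := by
    have := pow_le_pow_left₀ (by linarith) (min_le_right (α / √2) √α) 2
    rwa [Real.sq_sqrt (by linarith)] at this
  have hlog : 0 < Real.log θ := Real.log_pos hθ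
  obtain ⟨L', hL'⟩ := exists_nat_ge (-Real.log (θ - 1) / Real.log θ)
  rw [div_le_iff₀ hlog] at hL'
  refine ⟨L' + 1, by omega, fun n m hm hn => ?_⟩
  intro M _ _ hM
  have := Fintype.ofFinite M
  rw [Nat.card_eq_fintype_card] at hM
  have hm3 : 0 < (L' + 1) * m ^ 3 := by positivity
  have : Nontrivial M := Fintype.one_lt_card_iff_nontrivial.1 (by omega)
  obtain ⟨N, hN, hmin⟩ := exists_nearest_neighbor M
  obtain ⟨S, -, hSc, hS⟩ := exists_independent_of_map N hN Finset.univ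
  rw [Finset.card_univ, hM] at hSc
  have hpos : ∀ x, 0 < dist x (N x) := fun x => dist_pos.2 (hN x).symm
  let κ : M → ℤ := fun x => ⌊Real.log (dist x (N x)) / Real.log θ⌋
  have hκ1 : ∀ x, κ x * Real.log θ ≤ Real.log (dist x (N x)) := fun x => by
    rw [← le_div_iff₀ hlog]; exact Int.floor_le _
  have hκ2 : ∀ x, Real.log (dist x (N x)) < (κ x + 1) * Real.log θ := fun x => by
    rw [← div_lt_iff₀ hlog]; exact Int.lt_floor_add_one _
  have hLpos : (0 : ℤ) < ((L' + 1 : ℕ) : ℤ) := by positivity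
  obtain ⟨ρ, -, hρ⟩ := Finset.exists_le_card_fiber_of_mul_le_card_of_maps_to (s := S)
    (t := Finset.Ico (0 : ℤ) ((L' + 1 : ℕ) : ℤ)) (f := fun x => κ x % ((L' + 1 : ℕ) : ℤ))
    (n := m ^ 3)
    (fun x _ => Finset.mem_Ico.2 ⟨Int.emod_nonneg _ hLpos.ne', Int.emod_lt_of_pos _ hLpos⟩)
    ⟨0, Finset.mem_Ico.2 ⟨le_rfl, hLpos⟩⟩ (by simp only [Int.card_Ico]; simp; omega)
  set S' := S.filter fun x => κ x % ((L' + 1 : ℕ) : ℤ) = ρ with hS'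
  by_cases hcase : m ≤ (S'.image κ).card
  · obtain ⟨J, hJ, hJm⟩ := Finset.exists_subset_card_eq hcase
    let e := (J.equivFinOfCardEq hJm).symm
    have : ∀ i : Fin m, ∃ x ∈ S', κ x = e i := fun i => Finset.mem_image.1 (hJ (e i).2)
    choose x hxS' hx using this
    have hinj : Function.Injective x := fun i j hij =>
      e.injective (Subtype.ext (by rw [← hx, ← hx, hij]))
    have hstep : ∀ i j, κ (x i) < κ (x j) →
        dist (x i) (N (x i)) ≤ (θ - 1) * dist (x j) (N (x j)) := by
      intro i j hij
      have h1 : κ (x i) + ((L' + 1 : ℕ) : ℤ) ≤ κ (x j) := by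
        have hi := (Finset.mem_filter.1 (hxS' i)).2
        have hj := (Finset.mem_filter.1 (hxS' j)).2
        have hdvd : ((L' + 1 : ℕ) : ℤ) ∣ κ (x j) - κ (x i) :=
          Int.ModEq.dvd (hi.trans hj.symm)
        have := Int.le_of_dvd (by omega) hdvd
        omega
      have h2 : (κ (x i) : ℝ) + 1 + L' ≤ κ (x j) := by
        have : ((κ (x i) + ((L' + 1 : ℕ) : ℤ) : ℤ) : ℝ) ≤ κ (x j) := by exact_mod_cast h1
        push_cast at this
        linarith
      have h3 := hκ2 (x i)
      have h4 := hκ1 (x j)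
      have h5 : (κ (x i) + 1 + L') * Real.log θ ≤ κ (x j) * Real.log θ :=
        mul_le_mul_of_nonneg_right h2 hlog.le
      rw [← Real.log_le_log_iff (hpos _) (mul_pos (by linarith) (hpos _)),
        Real.log_mul (by linarith) (hpos _).ne']
      nlinarith
    obtain ⟨s, hs, hemb⟩ := exists_setoid_of_lacunary hmin hS x hinj
      (fun i => Finset.mem_of_mem_filter _ (hxS' i)) hθ (fun i j hij => by
        have hne : κ (x i) ≠ κ (x j) := by
          rw [hx, hx]
          exact fun h => hij (e.injective (Subtype.ext h))
        rcases lt_or_gt_of_ne hne with h | h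
        · exact Or.inl (hstep i j h)
        · exact Or.inr (hstep j i h))
    exact ⟨s, hs, hemb.mono hθ2⟩
  · have hS'ne : S'.Nonempty := Finset.card_pos.1 (lt_of_lt_of_le (by positivity) hρ)
    obtain ⟨k, -, hk⟩ := Finset.exists_le_card_fiber_of_mul_le_card_of_maps_to (s := S')
      (t := S'.image κ) (f := κ) (n := m * m) (fun x hx => Finset.mem_image_of_mem _ hx)
      (hS'ne.image κ) (by
        refine le_trans (Nat.mul_le_mul_right _ (not_le.1 hcase).le) (le_trans (le_of_eq ?_) hρ)
        ring)
    obtain ⟨s, hs, hemb⟩ := exists_setoid_of_same_scale hmin hS hm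
      ((Finset.filter_subset _ _).trans (Finset.filter_subset _ _)) hk hθ.le (fun x hx y hy => by
        have hxk := (Finset.mem_filter.1 hx).2
        have hyk := (Finset.mem_filter.1 hy).2
        have h1 := hκ2 x
        have h2 := hκ1 y
        rw [hxk] at h1
        rw [hyk] at h2
        rw [← Real.log_le_log_iff (hpos _) (mul_pos (by linarith) (hpos _)),
          Real.log_mul (by linarith) (hpos _).ne']
        linarith)
    exact ⟨s, hs, hemb.mono hθ1⟩

theorem two_mem_qSizes {α : ℝ} (hα : 1 ≤ α) {n : ℕ} (hn : 2 ≤ n) :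
    2 ∈ qSizes HilbertL2 α n := by
  intro M _ _ hM
  have := Fintype.ofFinite M
  rw [Nat.card_eq_fintype_card] at hM
  have : Nontrivial M := Fintype.one_lt_card_iff_nontrivial.1 (by omega)
  obtain ⟨N, hN, hmin⟩ := exists_nearest_neighbor M
  obtain ⟨x⟩ : Nonempty M := inferInstance
  obtain ⟨s, hs, hemb⟩ := exists_setoid_of_points hmin (S := {x}) (by simpa using hN x)
    (m := 1) (fun _ => x) (fun i j _ => Subsingleton.elim i j) (by simp) (a := 1) (b := 1)
    one_pos le_rfl le_rfl (fun i j hij => absurd (Subsingleton.elim i j) hij)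
    (fun i j hij => absurd (Subsingleton.elim i j) hij)
  exact ⟨s, hs, hemb.mono (by simpa using hα)⟩

theorem exists_rpow_le_Q₂ {α : ℝ} (hα : √2 < α) :
    ∃ c : ℝ, 0 < c ∧ c ≤ 1 / 3 ∧ ∀ n : ℕ, 1 ≤ n → (n : ℝ) ^ c ≤ (Q₂ α n : ℝ) := by
  obtain ⟨L, hL, h⟩ := exists_add_one_mem_qSizes hα
  have hs21 : (1 : ℝ) ≤ √2 := Real.one_le_sqrt.2 (by norm_num)
  obtain ⟨p, hp⟩ : ∃ p : ℕ, 3 * L ≤ 2 ^ p := ⟨3 * L, Nat.lt_two_pow_self.le⟩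
  refine ⟨1 / (p + 3 : ℕ), by positivity, ?_, fun n hn => ?_⟩
  · push_cast
    exact one_div_le_one_div_of_le (by norm_num) (by linarith [Nat.cast_nonneg (α := ℝ) p])
  rcases hn.eq_or_lt with rfl | hn2
  · obtain ⟨s, hs, -⟩ := exists_setoid_card_eq_Q₂ (α := α) le_rfl Unit (by simp)
    have : Nonempty (QSpace s) := ⟨QSpace.mk s ()⟩
    rw [← hs]
    rw [Nat.cast_one, Real.one_rpow]
    exact_mod_cast Nat.card_pos (α := QSpace s)
  have hQ2 : 2 ≤ Q₂ α n := le_Q₂ hn (two_mem_qSizes (by linarith) hn2)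
  have hmain : n ≤ 3 * (L * Q₂ α n ^ 3) := by
    by_contra! hlt
    have := le_Q₂ hn (h n (Q₂ α n) (by omega) hlt.le)
    omega
  have hpow : n ≤ Q₂ α n ^ (p + 3) := by
    calc n ≤ 3 * L * Q₂ α n ^ 3 := by rw [mul_assoc]; exact hmain
      _ ≤ Q₂ α n ^ p * Q₂ α n ^ 3 :=
        Nat.mul_le_mul_right _ (hp.trans (Nat.pow_le_pow_left hQ2 p))
      _ = Q₂ α n ^ (p + 3) := (pow_add _ _ _).symm
  have hpow' : (n : ℝ) ≤ (Q₂ α n : ℝ) ^ (p + 3) := by exact_mod_cast hpow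
  calc (n : ℝ) ^ (1 / (p + 3 : ℕ) : ℝ)
      ≤ ((Q₂ α n : ℝ) ^ (p + 3)) ^ (1 / (p + 3 : ℕ) : ℝ) :=
        Real.rpow_le_rpow (Nat.cast_nonneg _) hpow' (by positivity)
    _ = Q₂ α n := by
        rw [one_div, Real.pow_rpow_inv_natCast (Nat.cast_nonneg _) (by omega)]

/-! ### Spaces with distances `1` and `2`, and stars -/

open Classical in
/-- The metric on the vertices of a graph which is `1` on adjacent and `2` on nonadjacent pairs of
distinct points. Loops of `adj` play no role. -/
@[reducible] noncomputable def oneTwoMetric {V : Type*} (adj : V → V → Prop)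
    (hadj : ∀ x y, adj x y → adj y x) : MetricSpace V where
  dist x y := if x = y then 0 else if adj x y then 1 else 2
  dist_self x := by simp
  dist_comm x y := by
    have h : adj x y ↔ adj y x := ⟨hadj x y, hadj y x⟩
    simp only [eq_comm (a := x), h]
  dist_triangle x y z := by
    by_cases hxy : x = y
    · simp [hxy]
    by_cases hyz : y = z
    · simp [hyz]
    simp only [hxy, hyz, if_false]
    split_ifs <;> norm_num
  eq_of_dist_eq_zero {x y} h := by
    by_contra hxy
    simp only [hxy, if_false] at h
    split_ifs at h <;> norm_num at h

theorem oneTwoMetric_dist_of_adj {V : Type*} {adj : V → V → Prop}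
    (hadj : ∀ x y, adj x y → adj y x) {x y : V} (hxy : x ≠ y) (h : adj x y) :
    let _ := oneTwoMetric adj hadj
    dist x y = 1 :=
  (if_neg hxy).trans (if_pos h)

theorem oneTwoMetric_dist_of_not_adj {V : Type*} {adj : V → V → Prop}
    (hadj : ∀ x y, adj x y → adj y x) {x y : V} (hxy : x ≠ y) (h : ¬ adj x y) :
    let _ := oneTwoMetric adj hadj
    dist x y = 2 :=
  (if_neg hxy).trans (if_neg h)

theorem two_le_dist_mk {M : Type*} [MetricSpace M] [Finite M] {s : Setoid M}
    (h1 : ∀ u v : M, u ≠ v → 1 ≤ dist u v) {x y : M} (hxy : ¬ s x y)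
    (h2 : ∀ u v, s x u → s y v → 2 ≤ dist u v) :
    2 ≤ dist (QSpace.mk s x) (QSpace.mk s y) := by
  classical
  have hne : ∀ u, s x u → ¬ s y u := fun u hu hu' => hxy (s.trans hu (s.symm hu'))
  have := QSpace.le_dist_mk (s := s) (fun u => if s x u then (0 : ℝ) else if s y u then 2 else 1)
    ?_ ?_ x y
  · simpa [hxy, s.refl x, s.refl y] using this
  · intro u v
    have hd := dist_nonneg (x := u) (y := v)
    rcases eq_or_ne u v with rfl | huv
    · simp
    have hd1 := h1 u v huv
    by_cases hu : s x u
    · simp only [hu, if_true]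
      split_ifs <;> linarith
    by_cases hu' : s y u
    · by_cases hv : s x v
      · have := h2 v u hv hu'
        rw [dist_comm] at this
        simpa [hu, hu', hv] using this
      · simp only [hu, hu', hv, if_true, if_false]
        split_ifs <;> linarith
    · simp only [hu, hu', if_false]
      split_ifs <;> linarith
  · intro u v huv
    have e1 : s x u ↔ s x v := ⟨fun h => s.trans h huv, fun h => s.trans h (s.symm huv)⟩
    have e2 : s y u ↔ s y v := ⟨fun h => s.trans h huv, fun h => s.trans h (s.symm huv)⟩
    simp only [e1, e2]

theorem sum_norm_sub_sq {ι E : Type*} [NormedAddCommGroup E] [InnerProductSpace ℝ E]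
    (T : Finset ι) (g : ι → E) : ∑ x ∈ T, ∑ y ∈ T, ‖g x - g y‖ ^ 2 =
      2 * T.card * ∑ x ∈ T, ‖g x‖ ^ 2 - 2 * ‖∑ x ∈ T, g x‖ ^ 2 := by
  have h : ‖∑ x ∈ T, g x‖ ^ 2 = ∑ x ∈ T, ∑ y ∈ T, inner ℝ (g x) (g y) := by
    rw [← real_inner_self_eq_norm_sq, sum_inner]
    exact Finset.sum_congr rfl fun x _ => inner_sum _ _ _
  simp only [norm_sub_sq_real, Finset.sum_add_distrib, Finset.sum_sub_distrib, Finset.sum_const,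
    ← Finset.mul_sum, ← h, nsmul_eq_mul]
  ring

/-- Every Q space of the star `K_{1,n-1}` is a star, and a star with `k` leaves has Euclidean
distortion at least `√(2 * (1 - 1 / k))`. -/
theorem card_le_of_star {M : Type*} [MetricSpace M] [Finite M] (z : M)
    (hz : ∀ x, x ≠ z → dist z x = 1) (h2 : ∀ x y, x ≠ z → y ≠ z → x ≠ y → dist x y = 2)
    (s : Setoid M) {α β : ℝ} (hβ0 : 0 < β) (hαβ : α < β) (hβ : β ^ 2 < 2)
    (h : AlphaEmbeds α (QSpace s) HilbertL2) :
    (Nat.card (QSpace s) : ℝ) ≤ 1 + 2 / (2 - β ^ 2) := by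
  classical
  have hfrac : 0 < 2 / (2 - β ^ 2) := div_pos two_pos (by linarith)
  have := Fintype.ofFinite (QSpace s)
  rcases subsingleton_or_nontrivial (QSpace s) with hsub | hnt
  · have : Nat.card (QSpace s) ≤ 1 := Finite.card_le_one_iff_subsingleton.2 hsub
    have : (Nat.card (QSpace s) : ℝ) ≤ 1 := by exact_mod_cast this
    linarith
  obtain ⟨f, b, e, hb, he, hbe, hup, hlo⟩ := h.exists_lipschitz hβ0 hαβ
  set c := QSpace.mk s z with hc
  have hcdist : ∀ U, dist U c ≤ 1 := by
    intro U
    obtain ⟨x, rfl⟩ := U.exists_rep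
    refine (QSpace.dist_mk_le x z).trans ?_
    rcases eq_or_ne x z with rfl | hx
    · simp
    · rw [dist_comm, hz x hx]
  have hdist : ∀ U V, U ≠ c → V ≠ c → U ≠ V → 2 ≤ dist U V := by
    intro U V hU hV hUV
    obtain ⟨x, rfl⟩ := U.exists_rep
    obtain ⟨y, rfl⟩ := V.exists_rep
    refine two_le_dist_mk ?_ (fun h => hUV (QSpace.mk_eq_mk.2 h)) ?_
    · intro u v huv
      by_cases hu : u = z
      · rw [hu, hz v (fun h => huv (hu.trans h.symm))]
      by_cases hv : v = z
      · rw [hv, dist_comm, hz u hu]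
      rw [h2 u v hu hv huv]
      norm_num
    · intro u v hu hv
      refine (h2 u v ?_ ?_ ?_).ge
      · rintro rfl; exact hU (QSpace.mk_eq_mk.2 hu)
      · rintro rfl; exact hV (QSpace.mk_eq_mk.2 hv)
      · rintro rfl; exact hUV (QSpace.mk_eq_mk.2 (s.trans hu (s.symm hv)))
  set P : Finset (QSpace s) := Finset.univ.erase c with hP
  have hcard : Nat.card (QSpace s) = P.card + 1 := by
    rw [Nat.card_eq_fintype_card, hP, Finset.card_erase_add_one (Finset.mem_univ _),
      Finset.card_univ]
  set k : ℝ := (P.card : ℝ) with hk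
  have hk0 : 0 < k := by
    have h1 : 1 < Fintype.card (QSpace s) := Fintype.one_lt_card
    rw [Nat.card_eq_fintype_card] at hcard
    exact Nat.cast_pos.2 (by omega)
  have hid := sum_norm_sub_sq P (fun U => f U - f c)
  have hlow : k * ((k - 1) * (2 / e) ^ 2) ≤
      ∑ U ∈ P, ∑ V ∈ P, ‖(f U - f c) - (f V - f c)‖ ^ 2 := by
    rw [hk, ← nsmul_eq_mul]
    refine Finset.card_nsmul_le_sum _ _ _ fun U hU => ?_
    rw [← Finset.sum_erase_add _ _ hU]
    refine le_add_of_le_of_nonneg ?_ (by positivity)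
    have hce : ((P.erase U).card : ℝ) = P.card - 1 := by
      rw [Finset.card_erase_of_mem hU, Nat.cast_pred (Finset.card_pos.2 ⟨U, hU⟩)]
    rw [← hce, ← nsmul_eq_mul]
    refine Finset.card_nsmul_le_sum _ _ _ fun V hV => ?_
    have hne := Finset.ne_of_mem_erase hV
    have hVP := Finset.mem_of_mem_erase hV
    rw [sub_sub_sub_cancel_right, ← dist_eq_norm]
    refine pow_le_pow_left₀ (by positivity) ?_ 2
    rw [div_le_iff₀ he, mul_comm]
    exact (hdist U V (Finset.ne_of_mem_erase hU) (Finset.ne_of_mem_erase hVP) hne.symm).trans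
      (hlo U V)
  have hhigh : ∑ U ∈ P, ‖f U - f c‖ ^ 2 ≤ k * b ^ 2 := by
    rw [hk, ← nsmul_eq_mul]
    refine Finset.sum_le_card_nsmul _ _ _ fun U _ => ?_
    rw [← dist_eq_norm]
    refine pow_le_pow_left₀ dist_nonneg ((hup U c).trans ?_) 2
    have := hcdist U
    nlinarith
  have hmain : k * ((k - 1) * (2 / e) ^ 2) ≤ 2 * k * (k * b ^ 2) := by
    refine hlow.trans ?_
    rw [hid]
    have : 2 * k * ∑ U ∈ P, ‖f U - f c‖ ^ 2 ≤ 2 * k * (k * b ^ 2) :=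
      mul_le_mul_of_nonneg_left hhigh (by positivity)
    have h0 : 0 ≤ ‖∑ U ∈ P, (f U - f c)‖ ^ 2 := by positivity
    linarith
  have hmain2 : 2 * (k - 1) ≤ k * β ^ 2 := by
    have h1 : (k - 1) * (2 / e) ^ 2 ≤ 2 * k * b ^ 2 := by
      refine le_of_mul_le_mul_left (hmain.trans (le_of_eq ?_)) hk0
      ring
    have h3 : (k - 1) * 4 ≤ 2 * k * (b * e) ^ 2 := by
      have := mul_le_mul_of_nonneg_right h1 (sq_nonneg e)
      calc (k - 1) * 4 = (k - 1) * (2 / e) ^ 2 * e ^ 2 := by field_simp; norm_num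
        _ ≤ 2 * k * b ^ 2 * e ^ 2 := this
        _ = 2 * k * (b * e) ^ 2 := by ring
    have h4 : (b * e) ^ 2 ≤ β ^ 2 := pow_le_pow_left₀ (by positivity) hbe 2
    nlinarith
  rw [hcard, Nat.cast_add, Nat.cast_one, ← hk, add_comm]
  have : k ≤ 2 / (2 - β ^ 2) := by
    rw [le_div_iff₀ (by linarith)]
    linarith
  linarith

theorem exists_Q₂_le_const {α : ℝ} (hα : 1 < α) (hα2 : α < √2) :
    ∃ C : ℝ, ∀ n : ℕ, 1 ≤ n → (Q₂ α n : ℝ) ≤ C := by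
  obtain ⟨β, hβ1, hβ2⟩ := exists_between hα2
  have hβ0 : 0 < β := by linarith
  refine ⟨1 + 2 / (2 - β ^ 2), fun n hn => ?_⟩
  let z : Fin n := ⟨0, hn⟩
  have hsymm : ∀ x y : Fin n, (x = z ∨ y = z) → (y = z ∨ x = z) := fun x y h => h.symm
  let _ : MetricSpace (Fin n) := oneTwoMetric (fun x y => x = z ∨ y = z) hsymm
  obtain ⟨s, hs, hemb⟩ := exists_setoid_card_eq_Q₂ (α := α) hn (Fin n) (by simp)
  rw [← hs]
  refine card_le_of_star z ?_ ?_ s hβ0 hβ1 ((Real.lt_sqrt hβ0.le).1 hβ2) hemb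
  · exact fun x hx => oneTwoMetric_dist_of_adj hsymm hx.symm (Or.inl rfl)
  · exact fun x y hx hy hxy => oneTwoMetric_dist_of_not_adj hsymm hxy (by simp [hx, hy])

/-! ### Unions of Hamming cubes -/

/-- The four-point inequality: diagonals against sides of a quadrilateral. -/
theorem norm_sq_diagonals_le_sides {E : Type*} [NormedAddCommGroup E] [InnerProductSpace ℝ E]
    (a b c d : E) :
    ‖a - c‖ ^ 2 + ‖b - d‖ ^ 2 ≤ ‖a - b‖ ^ 2 + ‖b - c‖ ^ 2 + ‖c - d‖ ^ 2 + ‖d - a‖ ^ 2 := by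
  have h : 0 ≤ ‖a - b + c - d‖ ^ 2 := by positivity
  simp only [← real_inner_self_eq_norm_sq, inner_sub_left, inner_sub_right, inner_add_left,
    inner_add_right] at h ⊢
  have h1 := real_inner_comm a b
  have h2 := real_inner_comm a c
  have h3 := real_inner_comm a d
  have h4 := real_inner_comm b c
  have h5 := real_inner_comm b d
  have h6 := real_inner_comm c d
  linarith

/-- Enflo's inequality for the diagonals and edges of the Hamming cube. -/
theorem sum_norm_sq_antipodal_le {E : Type*} [NormedAddCommGroup E] [InnerProductSpace ℝ E]
    (d : ℕ) (f : (Fin d → Bool) → E) :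
    ∑ x, ‖f x - f (fun i => !x i)‖ ^ 2 ≤
      ∑ x, ∑ i, ‖f x - f (Function.update x i (!x i))‖ ^ 2 := by
  induction d with
  | zero =>
    refine Finset.sum_le_sum fun x _ => ?_
    rw [Subsingleton.elim (fun i => !x i) x]
    simp
  | succ d ih =>
    have hsum : ∀ g : (Fin (d + 1) → Bool) → ℝ, ∑ x, g x =
        ∑ x : Fin d → Bool, (g (Fin.cons true x) + g (Fin.cons false x)) := by
      intro g
      rw [← Equiv.sum_comp (Fin.consEquiv fun _ => Bool) g, Fintype.sum_prod_type,
        Fintype.sum_bool, ← Finset.sum_add_distrib]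
      rfl
    have hnot : ∀ (b : Bool) (x : Fin d → Bool),
        (fun i => !(Fin.cons b x : Fin (d + 1) → Bool) i) = Fin.cons (!b) (fun i => !x i) := by
      intro b x
      funext i
      refine Fin.cases ?_ (fun i => ?_) i <;> simp
    rw [hsum, hsum]
    simp only [Fin.sum_univ_succ, Fin.cons_zero, Fin.update_cons_zero, Fin.cons_succ,
      ← Fin.cons_update, hnot, Bool.not_true, Bool.not_false]
    have h1 := ih fun x => f (Fin.cons true x)
    have h0 := ih fun x => f (Fin.cons false x)
    -- Complementation permutes the vertices of the smaller cube.
    have hflip : ∑ x : Fin d → Bool,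
        ‖f (Fin.cons false (fun i => !x i)) - f (Fin.cons true (fun i => !x i))‖ ^ 2 =
        ∑ x : Fin d → Bool, ‖f (Fin.cons true x) - f (Fin.cons false x)‖ ^ 2 := by
      have hinv : Function.Involutive fun (x : Fin d → Bool) i => !x i := fun x => by simp
      rw [← Equiv.sum_comp hinv.toPerm
        (fun x : Fin d → Bool => ‖f (Fin.cons true x) - f (Fin.cons false x)‖ ^ 2)]
      refine Finset.sum_congr rfl fun x _ => ?_
      rw [norm_sub_rev]
      rfl
    have hflip' : ∑ x : Fin d → Bool,
        ‖f (Fin.cons false x) - f (Fin.cons true x)‖ ^ 2 =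
        ∑ x : Fin d → Bool, ‖f (Fin.cons true x) - f (Fin.cons false x)‖ ^ 2 :=
      Finset.sum_congr rfl fun x _ => by rw [norm_sub_rev]
    have hquad : ∑ x : Fin d → Bool,
        (‖f (Fin.cons true x) - f (Fin.cons false (fun i => !x i))‖ ^ 2 +
          ‖f (Fin.cons false x) - f (Fin.cons true (fun i => !x i))‖ ^ 2) ≤
        ∑ x : Fin d → Bool, (‖f (Fin.cons true x) - f (Fin.cons false x)‖ ^ 2 +
          ‖f (Fin.cons false x) - f (Fin.cons false (fun i => !x i))‖ ^ 2 +
          ‖f (Fin.cons false (fun i => !x i)) - f (Fin.cons true (fun i => !x i))‖ ^ 2 +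
          ‖f (Fin.cons true x) - f (Fin.cons true (fun i => !x i))‖ ^ 2) := by
      refine Finset.sum_le_sum fun x _ => ?_
      have := norm_sq_diagonals_le_sides (f (Fin.cons true x)) (f (Fin.cons false x))
        (f (Fin.cons false (fun i => !x i))) (f (Fin.cons true (fun i => !x i)))
      rwa [norm_sub_rev (f (Fin.cons true fun i => !x i)) (f (Fin.cons true x))] at this
    refine hquad.trans ?_
    simp only [Finset.sum_add_distrib] at h0 h1 hflip hflip' ⊢
    linarith

/-- The Hamming cube has Euclidean distortion at least `√d`; here it is a subset of `X`. -/
theorem natCast_le_sq_of_hamming {X : Type*} [MetricSpace X] {d : ℕ} (hd : 0 < d)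
    (p : (Fin d → Bool) → X) (hp : ∀ x y, dist (p x) (p y) = hammingDist x y) {α β : ℝ}
    (hβ : 0 < β) (hαβ : α < β) (h : AlphaEmbeds α X HilbertL2) : (d : ℝ) ≤ β ^ 2 := by
  have hanti : ∀ x : Fin d → Bool, hammingDist x (fun i => !x i) = d := by
    intro x
    simp [hammingDist]
  have hd' : (0 : ℝ) < d := Nat.cast_pos.2 hd
  have : Nontrivial X := by
    refine ⟨p (fun _ => true), p (fun i => !(fun _ => true) i), fun h => ?_⟩
    have h1 := hp (fun _ => true) (fun i => !(fun _ => true) i)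
    rw [hanti, h, dist_self] at h1
    exact hd'.ne h1
  obtain ⟨f, b, e, hb, he, hbe, hup, hlo⟩ := h.exists_lipschitz hβ hαβ
  have hE := sum_norm_sq_antipodal_le d fun x => f (p x)
  have hl : ∀ x : Fin d → Bool, (d / e) ^ 2 ≤ ‖f (p x) - f (p fun i => !x i)‖ ^ 2 := by
    intro x
    rw [← dist_eq_norm]
    refine pow_le_pow_left₀ (by positivity) ?_ 2
    rw [div_le_iff₀ he, mul_comm]
    have := hlo (p x) (p fun i => !x i)
    rwa [hp, hanti] at this
  have hr : ∀ (x : Fin d → Bool) i,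
      ‖f (p x) - f (p (Function.update x i (!x i)))‖ ^ 2 ≤ b ^ 2 := by
    intro x i
    rw [← dist_eq_norm]
    refine pow_le_pow_left₀ dist_nonneg ((hup _ _).trans ?_) 2
    have h1 : hammingDist x (Function.update x i (!x i)) ≤ 1 := by
      refine (Finset.card_le_card (t := {i}) fun j hj => ?_).trans (Finset.card_singleton i).le
      by_contra hji
      rw [Finset.mem_singleton] at hji
      simp [Function.update_of_ne hji] at hj
    rw [hp]
    have h2 : (hammingDist x (Function.update x i (!x i)) : ℝ) ≤ 1 := by exact_mod_cast h1
    nlinarith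
  have hN : (0 : ℝ) < (Finset.univ : Finset (Fin d → Bool)).card :=
    Nat.cast_pos.2 (Finset.card_pos.2 Finset.univ_nonempty)
  have h1 := (Finset.card_nsmul_le_sum Finset.univ _ _ fun x _ => hl x).trans (hE.trans
    (Finset.sum_le_card_nsmul Finset.univ _ (d • b ^ 2) fun x _ => by
      have := Finset.sum_le_card_nsmul Finset.univ _ _ fun i _ => hr x i
      simpa using this))
  rw [nsmul_eq_mul, nsmul_eq_mul, mul_le_mul_iff_right₀ hN, nsmul_eq_mul, div_pow,
    div_le_iff₀ (by positivity)] at h1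
  have h2 : (b * e) ^ 2 ≤ β ^ 2 := pow_le_pow_left₀ (by positivity) hbe 2
  have h3 : (d : ℝ) * d ≤ d * (b * e) ^ 2 := by
    calc (d : ℝ) * d = (d : ℝ) ^ 2 := (sq _).symm
      _ ≤ d * b ^ 2 * e ^ 2 := h1
      _ = d * (b * e) ^ 2 := by ring
  exact (le_of_mul_le_mul_left h3 hd').trans h2

/-- A union of Hamming cubes indexed by `ι`, at mutual distance `d`. -/
@[reducible] noncomputable def cubesMetric (d : ℕ) (hd : 0 < d) (ι : Type*) [DecidableEq ι] :
    MetricSpace ((Fin d → Bool) × ι) where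
  dist p q := if p.2 = q.2 then (hammingDist p.1 q.1 : ℝ) else d
  dist_self p := by simp
  dist_comm p q := by simp only [eq_comm (a := p.2), hammingDist_comm p.1]
  dist_triangle p q r := by
    have hle : ∀ x y : Fin d → Bool, (hammingDist x y : ℝ) ≤ d := fun x y => by
      have := hammingDist_le_card_fintype (x := x) (y := y)
      rw [Fintype.card_fin] at this
      exact_mod_cast this
    have h0 : ∀ x y : Fin d → Bool, (0 : ℝ) ≤ hammingDist x y := fun x y => Nat.cast_nonneg _
    have ht : (hammingDist p.1 r.1 : ℝ) ≤ hammingDist p.1 q.1 + hammingDist q.1 r.1 := by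
      exact_mod_cast hammingDist_triangle p.1 q.1 r.1
    have := hle p.1 r.1
    have := h0 p.1 q.1
    have := h0 q.1 r.1
    have hd0 : (0 : ℝ) ≤ d := Nat.cast_nonneg _
    by_cases hpq : p.2 = q.2
    · by_cases hqr : q.2 = r.2
      · simpa [hpq, hqr] using ht
      · simp [hpq, hqr]
    · by_cases hqr : q.2 = r.2
      · have : ¬ p.2 = r.2 := fun h => hpq (h.trans hqr.symm)
        simp [hqr, this]
      · simp only [hpq, hqr, if_false]
        split_ifs <;> linarith
  eq_of_dist_eq_zero {p q} h := by
    have hd' : (d : ℝ) ≠ 0 := Nat.cast_ne_zero.2 hd.ne'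
    by_cases hpq : p.2 = q.2
    · simp only [hpq, if_true, Nat.cast_eq_zero, hammingDist_eq_zero] at h
      exact Prod.ext h hpq
    · simp only [hpq, if_false] at h
      exact absurd h hd'

open Classical in
theorem card_nontrivial_add_le {M : Type*} [Fintype M] (s : Setoid M) :
    (Finset.univ.filter fun x => ∃ y, y ≠ x ∧ s x y).card + 2 * Nat.card (QSpace s) ≤
      2 * Fintype.card M := by
  have := Fintype.ofFinite (QSpace s)
  set Z := Finset.univ.filter fun x => ∃ y, y ≠ x ∧ s x y with hZ
  have h1 := Finset.card_eq_sum_card_fiberwise (s := Z) (t := Finset.univ) (f := QSpace.mk s)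
    (fun _ _ => Finset.mem_coe.2 (Finset.mem_univ _))
  have h2 := Finset.card_eq_sum_card_fiberwise (s := (Finset.univ : Finset M)) (t := Finset.univ)
    (f := QSpace.mk s) (fun _ _ => Finset.mem_coe.2 (Finset.mem_univ _))
  rw [Nat.card_eq_fintype_card, ← Finset.card_univ, ← Finset.card_univ, h1, h2,
    Finset.card_eq_sum_ones, Finset.mul_sum, Finset.mul_sum, ← Finset.sum_add_distrib]
  refine Finset.sum_le_sum fun U _ => ?_
  obtain ⟨x, rfl⟩ := U.exists_rep
  have hsub : (Z.filter fun y => QSpace.mk s y = QSpace.mk s x).card ≤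
      (Finset.univ.filter fun y => QSpace.mk s y = QSpace.mk s x).card :=
    Finset.card_le_card (Finset.filter_subset_filter _ (Finset.subset_univ _))
  have hpos : 0 < (Finset.univ.filter fun y => QSpace.mk s y = QSpace.mk s x).card :=
    Finset.card_pos.2 ⟨x, by simp⟩
  rcases (Z.filter fun y => QSpace.mk s y = QSpace.mk s x).eq_empty_or_nonempty with h0 | ⟨y, hy⟩
  · rw [h0, Finset.card_empty]
    omega
  · -- A class containing a nontrivial point has at least two elements.
    simp only [hZ, Finset.mem_filter, Finset.mem_univ, true_and] at hy
    obtain ⟨⟨y', hne, hyy'⟩, hyx⟩ := hy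
    have : 1 < (Finset.univ.filter fun y => QSpace.mk s y = QSpace.mk s x).card := by
      refine Finset.one_lt_card.2 ⟨y', ?_, y, ?_, hne⟩
      · simpa [← hyx] using QSpace.mk_eq_mk.2 (s.symm hyy')
      · simpa using hyx
    omega

/-- A Q space with `m` points of an `n`-point union of cubes merges at most `2 * (n - m)` points. If
there are more cubes than that, some cube consists of singleton classes, and then the Q space
contains it isometrically. -/
theorem Q₂_le_of_cubes {α β : ℝ} (hβ : 0 < β) (hαβ : α < β) {d : ℕ} (hdβ : β ^ 2 < d) {n : ℕ}
    (hn : 1 ≤ n) : n / 2 ^ d + 2 * Q₂ α n ≤ 2 * n := by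
  classical
  have hd : 0 < d := by
    have : (0 : ℝ) < d := by nlinarith
    exact_mod_cast this
  set k := n / 2 ^ d with hk
  let _ := cubesMetric d hd (Fin (k + 1))
  have hdist : ∀ p q : (Fin d → Bool) × Fin (k + 1),
      dist p q = if p.2 = q.2 then (hammingDist p.1 q.1 : ℝ) else d := fun p q => rfl
  have hpow : 0 < 2 ^ d := by positivity
  obtain ⟨T, hT1, -, hT⟩ := Finset.exists_subsuperset_card_eq
    (s := (Finset.univ : Finset ((Fin d → Bool) × Fin k)).map
      (Function.Embedding.prodMap (.refl _) Fin.castSuccEmb))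
    (t := (Finset.univ : Finset ((Fin d → Bool) × Fin (k + 1)))) (n := n) (Finset.subset_univ _)
    (by simpa using Nat.mul_div_le n (2 ^ d))
    (by simpa using (Nat.lt_mul_div_succ n hpow).le)
  have hmem : ∀ (x : Fin d → Bool) (i : Fin k), (x, i.castSucc) ∈ T := fun x i =>
    hT1 (Finset.mem_map.2 ⟨(x, i), Finset.mem_univ _, rfl⟩)
  obtain ⟨s, hs, hemb⟩ := exists_setoid_card_eq_Q₂ (α := α) hn T (by simpa using hT)
  have hZ := card_nontrivial_add_le s
  rw [hs, Fintype.card_coe, hT] at hZ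
  refine le_trans (Nat.add_le_add_right ?_ _) hZ
  by_contra! hlt
  -- Some cube consists of singleton classes.
  obtain ⟨i, hi⟩ : ∃ i : Fin k, ∀ (x : Fin d → Bool) (z : T), s ⟨_, hmem x i⟩ z →
      z = ⟨_, hmem x i⟩ := by
    by_contra! hcon
    choose x z hxz hne using hcon
    refine absurd (Finset.card_le_card_of_injOn (s := (Finset.univ : Finset (Fin k)))
      (t := Finset.univ.filter fun x => ∃ y, y ≠ x ∧ s x y) (fun i => (⟨_, hmem (x i) i⟩ : T)) (fun i _ => ?_) ?_) (by simpa using hlt)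
    · exact Finset.mem_coe.2 (Finset.mem_filter.2 ⟨Finset.mem_univ _, z i, hne i, hxz i⟩)
    · intro i _ j _ hij
      have := congrArg (fun t : T => (t : (Fin d → Bool) × Fin (k + 1)).2) hij
      exact Fin.castSucc_injective k this
  have hcube : ∀ x y : Fin d → Bool,
      dist (QSpace.mk s ⟨_, hmem x i⟩) (QSpace.mk s ⟨_, hmem y i⟩) = hammingDist x y := by
    intro x y
    have hval : dist (⟨_, hmem x i⟩ : T) ⟨_, hmem y i⟩ = hammingDist x y := by
      rw [Subtype.dist_eq, hdist]
      simp
    refine le_antisymm ((QSpace.dist_mk_le _ _).trans hval.le) ?_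
    -- The distance from a point of the cube is constant on the classes.
    have := QSpace.le_dist_mk (s := s) (fun u => dist (⟨_, hmem x i⟩ : T) u)
      (fun u v => by have := dist_triangle (⟨_, hmem x i⟩ : T) v u; rw [dist_comm v u] at this
                     linarith)
      (fun u v huv => ?_) ⟨_, hmem x i⟩ ⟨_, hmem y i⟩
    · simpa [hval] using this
    · by_cases hu : (u : (Fin d → Bool) × Fin (k + 1)).2 = i.castSucc
      · have hu' : u = ⟨_, hmem u.1.1 i⟩ := Subtype.ext (Prod.ext rfl hu)
        rw [hi u.1.1 v (hu' ▸ huv), ← hu']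
      by_cases hv : (v : (Fin d → Bool) × Fin (k + 1)).2 = i.castSucc
      · have hv' : v = ⟨_, hmem v.1.1 i⟩ := Subtype.ext (Prod.ext rfl hv)
        rw [hi v.1.1 u (hv' ▸ s.symm huv), ← hv']
      simp [Subtype.dist_eq, hdist, Ne.symm hu, Ne.symm hv]
  have := natCast_le_sq_of_hamming hd _ hcube hβ hαβ hemb
  linarith

theorem exists_Q₂_le_mul {α : ℝ} (hα : 0 < α) :
    ∃ (n₀ : ℕ) (C : ℝ), 0 < C ∧ C < 1 ∧ ∀ n : ℕ, n₀ ≤ n → (Q₂ α n : ℝ) ≤ C * n := by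
  obtain ⟨d, hd⟩ := exists_nat_gt ((α + 1) ^ 2)
  have hN : (1 : ℝ) ≤ 2 ^ d := one_le_pow₀ (by norm_num)
  have hfrac : 1 / (4 * 2 ^ d : ℝ) ≤ 1 / 4 := by
    refine one_div_le_one_div_of_le (by norm_num) (by linarith)
  have hfrac0 : 0 < 1 / (4 * 2 ^ d : ℝ) := by positivity
  refine ⟨2 ^ d, 1 - 1 / (4 * 2 ^ d), by linarith, by linarith, fun n hn => ?_⟩
  have hpos : 0 < 2 ^ d := by positivity
  have h := Q₂_le_of_cubes (α := α) (β := α + 1) (by linarith) (by linarith) hd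
    (show 1 ≤ n by omega)
  have hk : n ≤ 2 * 2 ^ d * (n / 2 ^ d) := by
    have h1 := Nat.lt_mul_div_succ n hpos
    have h2 : 1 ≤ n / 2 ^ d := (Nat.one_le_div_iff hpos).2 hn
    nlinarith
  have h' : ((n / 2 ^ d : ℕ) : ℝ) + 2 * Q₂ α n ≤ 2 * n := by exact_mod_cast h
  have hk' : (n : ℝ) ≤ 2 * 2 ^ d * ((n / 2 ^ d : ℕ) : ℝ) := by exact_mod_cast hk
  have h3 : 1 / (4 * 2 ^ d : ℝ) * n ≤ ((n / 2 ^ d : ℕ) : ℝ) / 2 := by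
    rw [div_mul_eq_mul_div, one_mul, div_le_iff₀ (by positivity)]
    linarith
  linarith

/-! ### A quasirandom graph on the plane over a finite field -/

section FiniteField

variable {q : ℕ} [Fact q.Prime]

/-- The graph on the plane over `ZMod q` in which `(a, b)` and `(c, d)` are adjacent if
`b + d = a * c`. It is `q`-regular, loops included, and two points with distinct first
coordinates have exactly one common neighbor. -/
def planeAdj {q : ℕ} (x y : ZMod q × ZMod q) : Prop := x.2 + y.2 = x.1 * y.1

instance {q : ℕ} (x y : ZMod q × ZMod q) : Decidable (planeAdj x y) :=
  inferInstanceAs (Decidable (_ = _))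

theorem planeAdj_symm {q : ℕ} (x y : ZMod q × ZMod q) (h : planeAdj x y) : planeAdj y x := by
  unfold planeAdj at h ⊢
  rw [add_comm, h, mul_comm]

theorem sum_planeAdj {E : Type*} [AddCommMonoid E] (v : ZMod q × ZMod q → E) (x : ZMod q × ZMod q) :
    (∑ y, if planeAdj x y then v y else 0) = ∑ a, v (a, x.1 * a - x.2) := by
  rw [Fintype.sum_prod_type]
  refine Finset.sum_congr rfl fun a _ => ?_
  have : ∀ b, planeAdj x (a, b) ↔ x.1 * a - x.2 = b := fun b => by
    unfold planeAdj
    rw [sub_eq_iff_eq_add', eq_comm]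
  simp only [this]
  rw [Finset.sum_ite_eq]
  simp

variable {E : Type*} [NormedAddCommGroup E] [InnerProductSpace ℝ E]

theorem sum_lines (v : ZMod q × ZMod q → E) :
    ∑ x : ZMod q × ZMod q, ∑ a, v (a, x.1 * a - x.2) = (q : ℝ) • ∑ x, v x := by
  rw [Finset.sum_comm, Fintype.sum_prod_type (f := v), Finset.smul_sum]
  refine Finset.sum_congr rfl fun a _ => ?_
  rw [Fintype.sum_prod_type]
  have : ∀ m : ZMod q, ∑ c, v (a, m * a - c) = ∑ u, v (a, u) := fun m =>
    Equiv.sum_comp (Equiv.subLeft (m * a)) fun u => v (a, u)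
  simp only [this, Finset.sum_const, Finset.card_univ, ZMod.card]
  exact (Nat.cast_smul_eq_nsmul ℝ _ _).symm

/-- Common neighbors are counted by a sum over pairs of columns `a`, `b` of the plane: for `a ≠ b`
every pair of points in these columns has exactly one common neighbor. -/
theorem sum_norm_sq_lines_le (v : ZMod q × ZMod q → E) :
    ∑ x : ZMod q × ZMod q, ‖∑ a, v (a, x.1 * a - x.2)‖ ^ 2 ≤
      ‖∑ x, v x‖ ^ 2 + q * ∑ x, ‖v x‖ ^ 2 := by
  have hexp : ∀ w : ZMod q → E, ‖∑ a, w a‖ ^ 2 = ∑ a, ∑ b, inner ℝ (w a) (w b) := by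
    intro w
    rw [← real_inner_self_eq_norm_sq, sum_inner]
    exact Finset.sum_congr rfl fun a _ => inner_sum _ _ _
  let C : ZMod q → E := fun a => ∑ u, v (a, u)
  have hterm : ∀ a b, ∑ x : ZMod q × ZMod q,
      inner ℝ (v (a, x.1 * a - x.2)) (v (b, x.1 * b - x.2)) ≤
      inner ℝ (C a) (C b) + if a = b then q * ∑ u, ‖v (a, u)‖ ^ 2 else 0 := by
    intro a b
    rw [Fintype.sum_prod_type]
    rcases eq_or_ne a b with rfl | hab
    · have : ∀ m : ZMod q, ∑ c, inner ℝ (v (a, m * a - c)) (v (a, m * a - c)) =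
          ∑ u, ‖v (a, u)‖ ^ 2 := fun m => by
        rw [← Equiv.sum_comp (Equiv.subLeft (m * a)) fun u => ‖v (a, u)‖ ^ 2]
        exact Finset.sum_congr rfl fun c _ => real_inner_self_eq_norm_sq _
      simp only [this, Finset.sum_const, Finset.card_univ, ZMod.card, if_true, nsmul_eq_mul]
      exact le_add_of_nonneg_left real_inner_self_nonneg
    · rw [if_neg hab, add_zero]
      refine le_of_eq ?_
      have h1 : ∀ m : ZMod q, ∑ c, inner ℝ (v (a, m * a - c)) (v (b, m * b - c)) =
          ∑ u, inner ℝ (v (a, u)) (v (b, u + m * (b - a))) := fun m => by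
        rw [← Equiv.sum_comp (Equiv.subLeft (m * a))
          fun u => inner ℝ (v (a, u)) (v (b, u + m * (b - a)))]
        refine Finset.sum_congr rfl fun c _ => ?_
        rw [Equiv.subLeft_apply, show m * a - c + m * (b - a) = m * b - c by ring]
      simp only [h1]
      rw [Finset.sum_comm, sum_inner]
      refine Finset.sum_congr rfl fun u _ => ?_
      rw [inner_sum, ← Equiv.sum_comp ((Equiv.mulRight₀ (b - a) (sub_ne_zero.2 hab.symm)).trans
        (Equiv.addLeft u)) fun w => inner ℝ (v (a, u)) (v (b, w))]
      rfl
  simp only [hexp]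
  rw [Finset.sum_comm]
  have hcomm : ∀ a : ZMod q, ∑ x : ZMod q × ZMod q, ∑ b,
      inner ℝ (v (a, x.1 * a - x.2)) (v (b, x.1 * b - x.2)) =
      ∑ b, ∑ x : ZMod q × ZMod q, inner ℝ (v (a, x.1 * a - x.2)) (v (b, x.1 * b - x.2)) :=
    fun a => Finset.sum_comm
  simp only [hcomm]
  refine (Finset.sum_le_sum fun a _ => Finset.sum_le_sum fun b _ => hterm a b).trans
    (le_of_eq ?_)
  simp only [Finset.sum_add_distrib, Finset.sum_ite_eq, Finset.mem_univ, if_true]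
  rw [← hexp C, ← Finset.mul_sum, ← Fintype.sum_prod_type (f := v),
    ← Fintype.sum_prod_type (f := fun x => ‖v x‖ ^ 2)]

/-- The adjacency operator differs from the averaging operator by an operator of norm at most
`√q`; everything is multiplied by `q`. -/
theorem sum_norm_sq_discrepancy_le (v : ZMod q × ZMod q → E) :
    ∑ x : ZMod q × ZMod q, ‖(q : ℝ) • ∑ a, v (a, x.1 * a - x.2) - ∑ y, v y‖ ^ 2 ≤
      (q : ℝ) ^ 3 * ∑ x, ‖v x‖ ^ 2 := by
  have h1 := sum_norm_sq_lines_le v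
  have h2 : ∑ x : ZMod q × ZMod q, inner ℝ (∑ a, v (a, x.1 * a - x.2)) (∑ y, v y) =
      q * ‖∑ y, v y‖ ^ 2 := by
    rw [← sum_inner, sum_lines, real_inner_smul_left, real_inner_self_eq_norm_sq]
  simp only [norm_sub_sq_real, norm_smul, real_inner_smul_left, mul_pow, Real.norm_natCast,
    Finset.sum_add_distrib, Finset.sum_sub_distrib, ← Finset.mul_sum, h2, Finset.sum_const,
    Finset.card_univ, Fintype.card_prod, ZMod.card, nsmul_eq_mul]
  push_cast
  have h3 := mul_le_mul_of_nonneg_left h1 (sq_nonneg (q : ℝ))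
  linarith

/-- The expander mixing estimate on a subset of the plane, with vector weights; `r` is `√q`. -/
theorem abs_mixing_le {ι : Type*} (P : Finset ι) (φ : ι → ZMod q × ZMod q)
    (hφ : Function.Injective φ) (u v : ι → E) {r : ℝ} (hr : 0 < r) (hrq : r ^ 2 = q) :
    |q * (∑ i ∈ P, ∑ j ∈ P, if planeAdj (φ i) (φ j) then inner ℝ (u i) (v j) else 0) -
      inner ℝ (∑ i ∈ P, u i) (∑ j ∈ P, v j)| ≤
      r ^ 3 / 2 * (∑ i ∈ P, ‖u i‖ ^ 2 + ∑ i ∈ P, ‖v i‖ ^ 2) := by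
  classical
  let v' : ZMod q × ZMod q → E := fun y => if y ∈ P.map ⟨φ, hφ⟩ then Function.extend φ v 0 y else 0
  have hsum : ∀ (G : E → ℝ) (_ : G 0 = 0)
      (c : ZMod q × ZMod q → Prop) [DecidablePred c],
      (∑ y, if c y then G (v' y) else 0) = ∑ j ∈ P, if c (φ j) then G (v j) else 0 := by
    intro G hG c _
    have : ∀ y, (if c y then G (v' y) else 0) = if y ∈ P.map ⟨φ, hφ⟩ then
        (if c y then G (Function.extend φ v 0 y) else 0) else 0 := by
      intro y
      by_cases hy : y ∈ P.map ⟨φ, hφ⟩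
      · simp only [v', if_pos hy]
      · simp only [v', if_neg hy, hG, ite_self]
    simp only [this]
    rw [Finset.sum_ite_mem, Finset.univ_inter, Finset.sum_map]
    simp only [Function.Embedding.coeFn_mk, hφ.extend_apply]
  have hsum' : ∀ (G : E → ℝ) (_ : G 0 = 0),
      ∑ y, G (v' y) = ∑ j ∈ P, G (v j) := by
    intro G hG
    simpa using hsum G hG fun _ => True
  let D : ZMod q × ZMod q → E := fun x =>
    (q : ℝ) • ∑ a, v' (a, x.1 * a - x.2) - ∑ y, v' y
  have hD : ∑ x, ‖D x‖ ^ 2 ≤ (q : ℝ) ^ 3 * ∑ i ∈ P, ‖v i‖ ^ 2 := by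
    have := sum_norm_sq_discrepancy_le v'
    rwa [hsum' (fun e => ‖e‖ ^ 2) (by simp)] at this
  have hDP : ∑ i ∈ P, ‖D (φ i)‖ ^ 2 ≤ ∑ x, ‖D x‖ ^ 2 := by
    have := Finset.sum_map P ⟨φ, hφ⟩ fun x => ‖D x‖ ^ 2
    simp only [Function.Embedding.coeFn_mk] at this
    rw [← this]
    exact Finset.sum_le_sum_of_subset_of_nonneg (Finset.subset_univ _) fun _ _ _ => by positivity
  have hkey : q * (∑ i ∈ P, ∑ j ∈ P, if planeAdj (φ i) (φ j) then inner ℝ (u i) (v j) else 0) -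
      inner ℝ (∑ i ∈ P, u i) (∑ j ∈ P, v j) = ∑ i ∈ P, inner ℝ (u i) (D (φ i)) := by
    rw [sum_inner, Finset.mul_sum, ← Finset.sum_sub_distrib]
    refine Finset.sum_congr rfl fun i _ => ?_
    simp only [D]
    rw [inner_sub_right, real_inner_smul_right, ← sum_planeAdj, inner_sum, inner_sum, inner_sum,
      hsum' (fun e => inner ℝ (u i) e) (inner_zero_right _),
      ← hsum (fun e => inner ℝ (u i) e) (inner_zero_right _)]
    congr 2
    refine Finset.sum_congr rfl fun y _ => ?_
    split_ifs
    · rfl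
    · rw [inner_zero_right]
  rw [hkey]
  have hr3 : 0 < r ^ 3 := by positivity
  have hpt : ∀ i, |inner ℝ (u i) (D (φ i))| ≤
      r ^ 3 / 2 * ‖u i‖ ^ 2 + (2 * r ^ 3)⁻¹ * ‖D (φ i)‖ ^ 2 := by
    intro i
    refine (abs_real_inner_le_norm _ _).trans ?_
    have h := sq_nonneg (r ^ 3 * ‖u i‖ - ‖D (φ i)‖)
    have h2 : r ^ 3 / 2 * ‖u i‖ ^ 2 + (2 * r ^ 3)⁻¹ * ‖D (φ i)‖ ^ 2 - ‖u i‖ * ‖D (φ i)‖ =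
        (2 * r ^ 3)⁻¹ * (r ^ 3 * ‖u i‖ - ‖D (φ i)‖) ^ 2 := by
      field_simp
      ring
    have h3 : 0 ≤ (2 * r ^ 3)⁻¹ * (r ^ 3 * ‖u i‖ - ‖D (φ i)‖) ^ 2 := by positivity
    linarith
  refine (Finset.abs_sum_le_sum_abs _ _).trans ((Finset.sum_le_sum fun i _ => hpt i).trans ?_)
  rw [Finset.sum_add_distrib, ← Finset.mul_sum, ← Finset.mul_sum, mul_add]
  refine add_le_add le_rfl ?_
  rw [inv_mul_le_iff₀ (by positivity)]
  refine (hDP.trans hD).trans (le_of_eq ?_)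
  rw [← hrq]
  ring

theorem mul_card_edges_le {ι : Type*} (P : Finset ι) (φ : ι → ZMod q × ZMod q)
    (hφ : Function.Injective φ) {r : ℝ} (hr : 0 < r) (hrq : r ^ 2 = q) :
    q * (∑ i ∈ P, ∑ j ∈ P, if planeAdj (φ i) (φ j) then (1 : ℝ) else 0) ≤
      (P.card : ℝ) ^ 2 + r ^ 3 * P.card := by
  have := (abs_le.1 (abs_mixing_le P φ hφ (fun _ => (1 : ℝ)) (fun _ => (1 : ℝ)) hr hrq)).2
  simp only [Finset.sum_const, nsmul_eq_mul, mul_one, norm_one, one_pow, RCLike.inner_apply,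
    conj_trivial] at this
  linarith

/-- A Poincaré-type inequality: for maps into a ball of radius `1`, the average squared distance
over the edges of a set of points is almost the average over all its pairs. -/
theorem sum_norm_sub_sq_le_edges {ι : Type*} (P : Finset ι) (φ : ι → ZMod q × ZMod q)
    (hφ : Function.Injective φ) (g : ι → E) (hg : ∀ i ∈ P, ‖g i‖ ≤ 1) {r : ℝ} (hr : 0 < r)
    (hrq : r ^ 2 = q) :
    ∑ i ∈ P, ∑ j ∈ P, ‖g i - g j‖ ^ 2 ≤
      q * (∑ i ∈ P, ∑ j ∈ P, if planeAdj (φ i) (φ j) then ‖g i - g j‖ ^ 2 else 0) +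
        4 * r ^ 3 * P.card := by
  have hg2 : ∑ i ∈ P, ‖g i‖ ^ 2 ≤ P.card := by
    have := Finset.sum_le_card_nsmul P (fun i => ‖g i‖ ^ 2) 1 fun i hi =>
      pow_le_one₀ (norm_nonneg _) (hg i hi)
    simpa using this
  have hg4 : ∑ i ∈ P, ‖‖g i‖ ^ 2‖ ^ 2 ≤ P.card := by
    have := Finset.sum_le_card_nsmul P (fun i => ‖‖g i‖ ^ 2‖ ^ 2) 1 fun i hi =>
      pow_le_one₀ (norm_nonneg _) (by
        rw [Real.norm_of_nonneg (by positivity)]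
        exact pow_le_one₀ (norm_nonneg _) (hg i hi))
    simpa using this
  have h1 := (abs_le.1 (abs_mixing_le P φ hφ (fun i => ‖g i‖ ^ 2) (fun _ => (1 : ℝ)) hr hrq)).1
  have h2 := (abs_le.1 (abs_mixing_le P φ hφ (fun _ => (1 : ℝ)) (fun i => ‖g i‖ ^ 2) hr hrq)).1
  have h3 := (abs_le.1 (abs_mixing_le P φ hφ g g hr hrq)).2
  rw [real_inner_self_eq_norm_sq] at h3
  simp only [Finset.sum_const, nsmul_eq_mul, mul_one, norm_one, one_pow, RCLike.inner_apply,
    conj_trivial, one_mul] at h1 h2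
  have hsplit : (∑ i ∈ P, ∑ j ∈ P, if planeAdj (φ i) (φ j) then ‖g i - g j‖ ^ 2 else 0) =
      (∑ i ∈ P, ∑ j ∈ P, if planeAdj (φ i) (φ j) then ‖g i‖ ^ 2 else 0) +
      (∑ i ∈ P, ∑ j ∈ P, if planeAdj (φ i) (φ j) then ‖g j‖ ^ 2 else 0) -
      2 * ∑ i ∈ P, ∑ j ∈ P, if planeAdj (φ i) (φ j) then inner ℝ (g i) (g j) else 0 := by
    simp only [Finset.mul_sum, ← Finset.sum_add_distrib, ← Finset.sum_sub_distrib]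
    refine Finset.sum_congr rfl fun i _ => Finset.sum_congr rfl fun j _ => ?_
    split_ifs
    · rw [norm_sub_sq_real]; ring
    · ring
  rw [hsplit, sum_norm_sub_sq]
  have hr3 : 0 < r ^ 3 := by positivity
  have e2 := mul_le_mul_of_nonneg_left hg2 hr3.le
  have e4 := mul_le_mul_of_nonneg_left hg4 hr3.le
  linarith

/-- A Q space with `t` classes of size at most `σ`, of a set of points of the plane with the
metric of `planeAdj`. One representative is chosen in each small class. Few pairs of small classes
are adjacent, so most pairs are at distance `2`, while edges between representatives have length
at most `1`; quasirandomness compares the two. -/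
theorem small_classes_le {M : Type*} [MetricSpace M] [Fintype M] (φ : M → ZMod q × ZMod q)
    (hφ : Function.Injective φ) (h1 : ∀ x y, x ≠ y → planeAdj (φ x) (φ y) → dist x y = 1)
    (h2 : ∀ x y, x ≠ y → ¬ planeAdj (φ x) (φ y) → dist x y = 2) (s : Setoid M)
    [Nontrivial (QSpace s)] {α β : ℝ} (hβ0 : 0 < β) (hαβ : α < β) (hβ : β ≤ 2)
    (h : AlphaEmbeds α (QSpace s) HilbertL2) {r : ℝ} (hr : 0 < r) (hrq : r ^ 2 = q) {σ : ℝ}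
    (S : Finset (QSpace s)) (hS0 : S.Nonempty)
    (hS : ∀ U ∈ S, (Nat.card {x : M // QSpace.mk s x = U} : ℝ) ≤ σ) :
    (4 - β ^ 2) * (S.card : ℝ) ≤
      68 * r ^ 3 + 4 + 4 * σ ^ 2 * S.card / r ^ 2 + 4 * r * σ := by
  classical
  obtain ⟨f, b, e, hb, he, hbe, hup, hlo⟩ := h.exists_lipschitz hβ0 hαβ
  choose rep hrep using fun U : QSpace s => U.exists_rep
  have hrepinj : Function.Injective rep := fun U V hUV => by rw [← hrep U, ← hrep V, hUV]
  have hle2 : ∀ x y : M, dist x y ≤ 2 := by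
    intro x y
    rcases eq_or_ne x y with rfl | hxy
    · simp
    by_cases ha : planeAdj (φ x) (φ y)
    · rw [h1 x y hxy ha]; norm_num
    · rw [h2 x y hxy ha]
  have hge1 : ∀ x y : M, x ≠ y → 1 ≤ dist x y := by
    intro x y hxy
    by_cases ha : planeAdj (φ x) (φ y)
    · rw [h1 x y hxy ha]
    · rw [h2 x y hxy ha]; norm_num
  have hdQ : ∀ U V : QSpace s, dist U V ≤ 2 := by
    intro U V
    rw [← hrep U, ← hrep V]
    exact (QSpace.dist_mk_le _ _).trans (hle2 _ _)
  set t : ℝ := (S.card : ℝ) with ht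
  have ht0 : 0 < t := Nat.cast_pos.2 (Finset.card_pos.2 hS0)
  obtain ⟨U₀, -⟩ := hS0
  -- The map is rescaled to take values in the unit ball.
  let g : QSpace s → HilbertL2 := fun U => (2 * b)⁻¹ • (f U - f U₀)
  have hgdist : ∀ U V, ‖g U - g V‖ = (2 * b)⁻¹ * dist (f U) (f V) := by
    intro U V
    simp only [g]
    rw [← smul_sub, sub_sub_sub_cancel_right, norm_smul, ← dist_eq_norm,
      Real.norm_of_nonneg (by positivity)]
  have hg1 : ∀ U ∈ S, ‖g U‖ ≤ 1 := by
    intro U _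
    have : g U = g U - g U₀ := by simp [g]
    rw [this, hgdist, inv_mul_le_iff₀ (by positivity)]
    have := hup U U₀
    have := hdQ U U₀
    nlinarith
  have hpoin := sum_norm_sub_sq_le_edges S (fun U => φ (rep U)) (hφ.comp hrepinj) g hg1 hr hrq
  have hedge := mul_card_edges_le S (fun U => φ (rep U)) (hφ.comp hrepinj) hr hrq
  rw [← ht] at hpoin hedge
  have hupper : (∑ U ∈ S, ∑ V ∈ S,
      if planeAdj (φ (rep U)) (φ (rep V)) then ‖g U - g V‖ ^ 2 else 0) ≤
      1 / 4 * ∑ U ∈ S, ∑ V ∈ S, if planeAdj (φ (rep U)) (φ (rep V)) then (1 : ℝ) else 0 := by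
    simp only [Finset.mul_sum]
    refine Finset.sum_le_sum fun U _ => Finset.sum_le_sum fun V _ => ?_
    by_cases ha : planeAdj (φ (rep U)) (φ (rep V))
    · rw [if_pos ha, if_pos ha, mul_one]
      have hd1 : dist U V ≤ 1 := by
        rcases eq_or_ne U V with rfl | hUV
        · simp
        · have := QSpace.dist_mk_le (s := s) (rep U) (rep V)
          rw [hrep, hrep] at this
          exact this.trans (h1 _ _ (hrepinj.ne hUV) ha).le
      have hh : ‖g U - g V‖ ≤ 1 / 2 := by
        rw [hgdist, inv_mul_le_iff₀ (by positivity)]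
        have := hup U V
        nlinarith
      calc ‖g U - g V‖ ^ 2 ≤ (1 / 2) ^ 2 := pow_le_pow_left₀ (norm_nonneg _) hh 2
        _ = 1 / 4 := by norm_num
    · rw [if_neg ha, if_neg ha, mul_zero]
  -- Adjacent pairs of small classes are charged to edges between points of small classes.
  let T : Finset M := Finset.univ.filter fun x => QSpace.mk s x ∈ S
  have hTcard : (T.card : ℝ) ≤ σ * t := by
    have hc := Finset.card_eq_sum_card_fiberwise (s := T) (t := S) (f := QSpace.mk s)
      (fun x hx => (Finset.mem_filter.1 (Finset.mem_coe.1 hx)).2)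
    rw [hc, Nat.cast_sum, mul_comm, ht, ← nsmul_eq_mul]
    refine Finset.sum_le_card_nsmul _ _ _ fun U hU => le_trans ?_ (hS U hU)
    rw [Nat.card_eq_fintype_card, Fintype.card_subtype]
    exact_mod_cast Finset.card_le_card (Finset.filter_subset_filter _ (Finset.subset_univ _))
  have hedgeT := mul_card_edges_le T φ hφ hr hrq
  set eT : ℝ := ∑ x ∈ T, ∑ y ∈ T, if planeAdj (φ x) (φ y) then (1 : ℝ) else 0 with heT
  let A : QSpace s → QSpace s → Prop := fun U V =>
    ∃ x y, QSpace.mk s x = U ∧ QSpace.mk s y = V ∧ planeAdj (φ x) (φ y)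
  have hA : (∑ U ∈ S, ∑ V ∈ S, if A U V then (1 : ℝ) else 0) ≤ eT := by
    rw [heT, ← Finset.sum_product', ← Finset.sum_product',
      Finset.sum_boole, Finset.sum_boole, Nat.cast_le]
    refine Finset.card_le_card_of_surjOn
      (fun p : M × M => (QSpace.mk s p.1, QSpace.mk s p.2)) ?_
    rintro ⟨U, V⟩ hUV
    simp only [Finset.coe_filter, Finset.mem_product, Set.mem_ofPred_eq] at hUV
    obtain ⟨⟨hU, hV⟩, x, y, rfl, rfl, hxy⟩ := hUV
    refine ⟨(x, y), ?_, rfl⟩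
    simpa [T] using ⟨⟨hU, hV⟩, hxy⟩
  have hlower : (1 / β ^ 2) * (t ^ 2 - t - eT) ≤ ∑ U ∈ S, ∑ V ∈ S, ‖g U - g V‖ ^ 2 := by
    have hpt : ∀ U ∈ S, ∀ V ∈ S, (1 / β ^ 2) * (1 - (if U = V then (1 : ℝ) else 0) -
        if A U V then (1 : ℝ) else 0) ≤ ‖g U - g V‖ ^ 2 := by
      intro U _ V _
      by_cases hUV : U = V
      · rw [if_pos hUV]
        refine le_trans ?_ (by positivity : (0 : ℝ) ≤ ‖g U - g V‖ ^ 2)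
        refine mul_nonpos_of_nonneg_of_nonpos (by positivity) ?_
        split_ifs <;> norm_num
      by_cases hAUV : A U V
      · rw [if_neg hUV, if_pos hAUV]
        refine le_trans (by simp) (by positivity : (0 : ℝ) ≤ ‖g U - g V‖ ^ 2)
      rw [if_neg hUV, if_neg hAUV, sub_zero, sub_zero, mul_one]
      have hd : 2 ≤ dist U V := by
        rw [← hrep U, ← hrep V]
        refine two_le_dist_mk hge1 (fun h => hUV ?_) fun u v hu hv => ?_
        · rw [← hrep U, ← hrep V]
          exact QSpace.mk_eq_mk.2 h
        have eu : QSpace.mk s u = U := by rw [← hrep U]; exact QSpace.mk_eq_mk.2 (s.symm hu)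
        have ev : QSpace.mk s v = V := by rw [← hrep V]; exact QSpace.mk_eq_mk.2 (s.symm hv)
        refine (h2 u v ?_ fun ha => hAUV ⟨u, v, eu, ev, ha⟩).ge
        rintro rfl
        exact hUV (eu.symm.trans ev)
      have hge : 1 / β ≤ ‖g U - g V‖ := by
        rw [hgdist, div_le_iff₀ hβ0]
        have h3 := hlo U V
        have h4 : 2 ≤ e * dist (f U) (f V) := hd.trans h3
        have h5 : 2 * b ≤ dist (f U) (f V) * (b * e) := by nlinarith
        have h6 : dist (f U) (f V) * (b * e) ≤ dist (f U) (f V) * β :=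
          mul_le_mul_of_nonneg_left hbe dist_nonneg
        rw [mul_assoc, le_inv_mul_iff₀ (by positivity), mul_one]
        linarith
      calc 1 / β ^ 2 = (1 / β) ^ 2 := by rw [div_pow, one_pow]
        _ ≤ ‖g U - g V‖ ^ 2 := pow_le_pow_left₀ (by positivity) hge 2
    refine le_trans ?_ (Finset.sum_le_sum fun U hU => Finset.sum_le_sum fun V hV => hpt U hU V hV)
    simp only [← Finset.mul_sum, Finset.sum_sub_distrib]
    refine mul_le_mul_of_nonneg_left ?_ (by positivity)
    have hdiag : (∑ U ∈ S, ∑ V ∈ S, if U = V then (1 : ℝ) else 0) = t := by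
      rw [ht, Finset.card_eq_sum_ones, Nat.cast_sum]
      refine Finset.sum_congr rfl fun U hU => ?_
      rw [Finset.sum_ite_eq, if_pos hU, Nat.cast_one]
    rw [hdiag]
    simp only [Finset.sum_const, nsmul_eq_mul, mul_one, ← ht]
    have : t ^ 2 = t * t := sq t
    linarith
  have hr2 : 0 < r ^ 2 := by positivity
  have heT2 : eT ≤ (σ ^ 2 * t ^ 2) / r ^ 2 + r * σ * t := by
    have h3 : r ^ 2 * eT ≤ (σ * t) ^ 2 + r ^ 3 * (σ * t) := by
      rw [hrq]
      refine hedgeT.trans (add_le_add ?_ (mul_le_mul_of_nonneg_left hTcard (by positivity)))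
      exact pow_le_pow_left₀ (Nat.cast_nonneg _) hTcard 2
    rw [← sub_le_iff_le_add, le_div_iff₀ hr2]
    nlinarith
  have hβ2 : 0 < β ^ 2 := by positivity
  have hβ4 : β ^ 2 ≤ 4 := by nlinarith
  have hq0 : (0 : ℝ) ≤ q := Nat.cast_nonneg _
  have hfin : t ^ 2 - t - eT ≤ β ^ 2 * ((t ^ 2 + r ^ 3 * t) / 4 + 4 * r ^ 3 * t) := by
    have h3 := hlower.trans hpoin
    have h4 := mul_le_mul_of_nonneg_left hupper hq0
    have h5 : (1 / β ^ 2) * (t ^ 2 - t - eT) ≤ (t ^ 2 + r ^ 3 * t) / 4 + 4 * r ^ 3 * t := by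
      linarith
    rwa [one_div, inv_mul_le_iff₀ hβ2] at h5
  have hr3 : 0 < r ^ 3 * t := by positivity
  have hall : t * ((4 - β ^ 2) * t) ≤
      t * (68 * r ^ 3 + 4 + 4 * σ ^ 2 * t / r ^ 2 + 4 * r * σ) := by
    have h6 : β ^ 2 * (17 * (r ^ 3 * t)) ≤ 4 * (17 * (r ^ 3 * t)) :=
      mul_le_mul_of_nonneg_right hβ4 (by positivity)
    have h7 : t * (4 * σ ^ 2 * t / r ^ 2) = 4 * ((σ ^ 2 * t ^ 2) / r ^ 2) := by ring
    linarith
  exact le_of_mul_le_mul_left hall ht0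

end FiniteField

theorem exists_Q₂_le_rpow {α : ℝ} (hα0 : 0 < α) (hα : α < 2) :
    ∃ n₀ : ℕ, ∀ n : ℕ, n₀ ≤ n → (Q₂ α n : ℝ) ≤ (n : ℝ) ^ (7 / 8 : ℝ) := by
  classical
  obtain ⟨β, hβ1, hβ2⟩ := exists_between hα
  have hβ0 : 0 < β := by linarith
  have hgap : 0 < 4 - β ^ 2 := by nlinarith
  obtain ⟨n₁, hn₁⟩ := exists_nat_gt ((600 / (4 - β ^ 2)) ^ 8)
  refine ⟨n₁ + 1, fun n hn => ?_⟩
  by_contra! hlt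
  have hn1 : 1 ≤ n := by omega
  have hnR : (1 : ℝ) ≤ n := by exact_mod_cast hn1
  -- In terms of `y = n ^ (1 / 8)` all estimates are polynomial.
  set y : ℝ := (n : ℝ) ^ (1 / 8 : ℝ) with hy
  have hy1 : 1 ≤ y := Real.one_le_rpow hnR (by norm_num)
  have hy0 : 0 < y := by linarith
  have hy8 : y ^ 8 = n := by
    rw [hy, ← Real.rpow_natCast, ← Real.rpow_mul (by positivity)]
    norm_num
  have hy7 : y ^ 7 = (n : ℝ) ^ (7 / 8 : ℝ) := by
    rw [hy, ← Real.rpow_natCast, ← Real.rpow_mul (by positivity)]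
    norm_num
  rw [← hy7] at hlt
  have hybig : 600 / (4 - β ^ 2) < y := by
    refine lt_of_pow_lt_pow_left₀ 8 hy0.le ?_
    rw [hy8]
    refine hn₁.trans_le ?_
    exact_mod_cast (by omega : n₁ ≤ n)
  have hsq0 : Nat.sqrt n ≠ 0 := (Nat.sqrt_pos.2 hn1).ne'
  obtain ⟨q, hq, hq1, hq2⟩ := Nat.exists_prime_lt_and_le_two_mul (Nat.sqrt n) hsq0
  have : Fact q.Prime := ⟨hq⟩
  have hqn : n ≤ q * q := (Nat.sqrt_lt.1 hq1).le
  have hqn' : q * q ≤ 4 * n := by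
    have := Nat.sqrt_le n
    nlinarith
  obtain ⟨T, -, hT⟩ := Finset.exists_subset_card_eq
    (s := (Finset.univ : Finset (ZMod q × ZMod q))) (n := n) (by simpa [ZMod.card] using hqn)
  have hsymm : ∀ x y : T, planeAdj (x : ZMod q × ZMod q) y → planeAdj (y : ZMod q × ZMod q) x :=
    fun x y => planeAdj_symm _ _
  let _ : MetricSpace T := oneTwoMetric (fun x y => planeAdj (x : ZMod q × ZMod q) y) hsymm
  obtain ⟨s, hs, hemb⟩ := exists_setoid_card_eq_Q₂ (α := α) hn1 T (by simpa using hT)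
  have hfin := Fintype.ofFinite (QSpace s)
  rw [Nat.card_eq_fintype_card] at hs
  have hm1 : (1 : ℝ) < Q₂ α n := lt_of_le_of_lt (one_le_pow₀ hy1) hlt
  have hnt : Nontrivial (QSpace s) := by
    rw [← Fintype.one_lt_card_iff_nontrivial, hs]
    exact_mod_cast hm1
  let S : Finset (QSpace s) := Finset.univ.filter fun U =>
    (Nat.card {x : T // QSpace.mk s x = U} : ℝ) ≤ 2 * y
  -- Fewer than half of the classes have more than `2 * y` elements.
  have hScard : y ^ 7 / 2 ≤ (S.card : ℝ) := by
    have hsum : (∑ U : QSpace s, (Nat.card {x : T // QSpace.mk s x = U} : ℝ)) = y ^ 8 := by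
      rw [hy8, ← Nat.cast_sum, Nat.cast_inj, ← hT, ← Fintype.card_coe, ← Finset.card_univ,
        Finset.card_eq_sum_card_fiberwise (s := (Finset.univ : Finset T)) (t := Finset.univ)
          (f := QSpace.mk s) (fun _ _ => Finset.mem_coe.2 (Finset.mem_univ _))]
      refine Finset.sum_congr rfl fun U _ => ?_
      rw [Nat.card_eq_fintype_card, Fintype.card_subtype]
    have hbig : ((Finset.univ.filter fun U : QSpace s =>
        ¬ (Nat.card {x : T // QSpace.mk s x = U} : ℝ) ≤ 2 * y).card : ℝ) * (2 * y) ≤ y ^ 8 := by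
      rw [← hsum, ← nsmul_eq_mul]
      refine (Finset.card_nsmul_le_sum _ _ _ fun U hU => ?_).trans
        (Finset.sum_le_sum_of_subset_of_nonneg (Finset.filter_subset _ _)
          fun _ _ _ => Nat.cast_nonneg _)
      exact (not_le.1 (Finset.mem_filter.1 hU).2).le
    have htot := Finset.card_filter_add_card_filter_not (s := (Finset.univ : Finset (QSpace s)))
      (fun U => (Nat.card {x : T // QSpace.mk s x = U} : ℝ) ≤ 2 * y)
    rw [Finset.card_univ, hs] at htot
    have htot' : (S.card : ℝ) + ((Finset.univ.filter fun U : QSpace s =>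
        ¬ (Nat.card {x : T // QSpace.mk s x = U} : ℝ) ≤ 2 * y).card : ℝ) = Q₂ α n := by
      exact_mod_cast htot
    have h8 : y ^ 8 = y ^ 7 / 2 * (2 * y) := by ring
    rw [h8] at hbig
    have := le_of_mul_le_mul_right hbig (by positivity)
    linarith
  have hS0 : 0 < (S.card : ℝ) := lt_of_lt_of_le (by positivity) hScard
  have hr : 0 < √(q : ℝ) := Real.sqrt_pos.2 (Nat.cast_pos.2 hq.pos)
  have hrq : √(q : ℝ) ^ 2 = q := Real.sq_sqrt (Nat.cast_nonneg _)
  have key := small_classes_le (fun x : T => (x : ZMod q × ZMod q)) Subtype.val_injective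
    (fun x y hxy h => oneTwoMetric_dist_of_adj hsymm hxy h)
    (fun x y hxy h => oneTwoMetric_dist_of_not_adj hsymm hxy h) s hβ0 hβ1 hβ2.le hemb hr hrq
    (σ := 2 * y) S (Finset.card_pos.1 (by exact_mod_cast hS0))
    (fun U hU => (Finset.mem_filter.1 hU).2)
  set r := √(q : ℝ)
  set t : ℝ := (S.card : ℝ)
  have hqR : y ^ 4 ≤ r ^ 2 := by
    rw [hrq]
    refine le_of_sq_le_sq ?_ (Nat.cast_nonneg _)
    have : (n : ℝ) ≤ q * q := by exact_mod_cast hqn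
    calc (y ^ 4) ^ 2 = y ^ 8 := by ring
      _ ≤ (q : ℝ) ^ 2 := by rw [hy8, sq]; exact this
  have hqR' : r ^ 2 ≤ 2 * y ^ 4 := by
    rw [hrq]
    refine le_of_sq_le_sq ?_ (by positivity)
    have : (q : ℝ) * q ≤ 4 * n := by exact_mod_cast hqn'
    calc (q : ℝ) ^ 2 ≤ 4 * y ^ 8 := by rw [hy8, sq]; exact this
      _ = (2 * y ^ 4) ^ 2 := by ring
  have hr2 : r ≤ 2 * y ^ 2 := by
    refine le_of_sq_le_sq (hqR'.trans ?_) (by positivity)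
    nlinarith [pow_pos hy0 4]
  have hr3 : r ^ 3 ≤ 4 * y ^ 6 := by
    calc r ^ 3 = r ^ 2 * r := by ring
      _ ≤ (2 * y ^ 4) * (2 * y ^ 2) := mul_le_mul hqR' hr2 hr.le (by positivity)
      _ = 4 * y ^ 6 := by ring
  have hterm : 4 * (2 * y) ^ 2 * t / r ^ 2 ≤ 16 * t / y := by
    rw [div_le_div_iff₀ (by positivity) hy0]
    have h3 : y ^ 3 ≤ r ^ 2 := (pow_le_pow_right₀ hy1 (by norm_num)).trans hqR
    have := mul_le_mul_of_nonneg_left h3 (by positivity : 0 ≤ 16 * t)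
    calc 4 * (2 * y) ^ 2 * t * y = 16 * t * y ^ 3 := by ring
      _ ≤ 16 * t * r ^ 2 := this
  have hy6 : y ^ 6 ≤ 2 * t / y := by
    rw [le_div_iff₀ hy0]
    calc y ^ 6 * y = 2 * (y ^ 7 / 2) := by ring
      _ ≤ 2 * t := by linarith
  have hy3 : y ^ 3 ≤ y ^ 6 := pow_le_pow_right₀ hy1 (by norm_num)
  have hy6' : 1 ≤ y ^ 6 := one_le_pow₀ hy1
  have hrσ : 4 * r * (2 * y) ≤ 16 * y ^ 3 := by nlinarith
  have hfinal : (4 - β ^ 2) * t ≤ 600 * t / y := by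
    have e1 : 600 * t / y = 292 * (2 * t / y) + 16 * t / y := by ring
    rw [e1]
    linarith
  rw [mul_comm, mul_div_right_comm, mul_comm (600 / y)] at hfinal
  have hfin2 := le_of_mul_le_mul_left hfinal hS0
  rw [div_lt_iff₀ hgap] at hybig
  rw [le_div_iff₀ hy0] at hfin2
  linarith

end MetricQuotient

theorem theorem1p6 :
    (∀ α : ℝ, 1 < α → α < Real.sqrt 2 →
      ∃ C₁ : ℝ, ∀ n : ℕ, 1 ≤ n → (MetricQuotient.Q₂ α n : ℝ) ≤ C₁) ∧
    (∀ α : ℝ, Real.sqrt 2 < α → α < 2 →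
      ∃ c C : ℝ, 0 < c ∧ c ≤ C ∧ C < 1 ∧
        (∀ n : ℕ, 1 ≤ n → (n : ℝ) ^ c ≤ (MetricQuotient.Q₂ α n : ℝ)) ∧
        ∃ n₀ : ℕ, ∀ n : ℕ, n₀ ≤ n → (MetricQuotient.Q₂ α n : ℝ) ≤ (n : ℝ) ^ C) ∧
    (∀ α : ℝ, 2 ≤ α →
      ∃ (n₀ : ℕ) (c' C' : ℝ), 0 < c' ∧ c' < 1 ∧ 0 < C' ∧ C' < 1 ∧
        ∀ n : ℕ, n₀ ≤ n →
          c' * (n : ℝ) ≤ (MetricQuotient.Q₂ α n : ℝ) ∧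
          (MetricQuotient.Q₂ α n : ℝ) ≤ C' * (n : ℝ)) := by
  refine ⟨fun α h1 h2 => MetricQuotient.exists_Q₂_le_const h1 h2, fun α h1 h2 => ?_,
    fun α hα => ?_⟩
  · obtain ⟨c, hc0, hc1, hc⟩ := MetricQuotient.exists_rpow_le_Q₂ h1
    exact ⟨c, 7 / 8, hc0, by linarith, by norm_num, hc,
      MetricQuotient.exists_Q₂_le_rpow (by linarith [Real.sqrt_nonneg 2]) h2⟩
  · obtain ⟨n₀, C, hC0, hC1, hC⟩ := MetricQuotient.exists_Q₂_le_mul (α := α) (by linarith)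
    refine ⟨max n₀ 2, 1 / 3, C, by norm_num, by norm_num, hC0, hC1, fun n hn => ⟨?_, ?_⟩⟩
    · have hn2 : 2 ≤ n := (le_max_right _ _).trans hn
      have h := MetricQuotient.le_Q₂ (by omega)
        (MetricQuotient.div_three_add_one_mem_qSizes hα hn2)
      have h3 : n ≤ 3 * MetricQuotient.Q₂ α n := by omega
      have h3' : (n : ℝ) ≤ 3 * MetricQuotient.Q₂ α n := by exact_mod_cast h3
      linarith
    · exact hC n ((le_max_left _ _).trans hn)
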